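/- **Theorem (Ziegler).** Let $r\ge 2$ and let $n\ge 4$ be even. Then there is a polytope $P^r_n\subset\mathbb{R}^{2r}$ that is a deformed product of $r$ $n$-gons (in particular, it is combinatorially equivalent to the product of $r$ $n$-gons) such that all vertices, all edges and all $n$-gon $2$-faces of $P^r_n$ are strictly preserved by the projection $\pi:\mathbb{R}^{2r}\to\mathbb{R}^4$ to the last $4$ coordinates. Here the terms are used as follows. * A *deformed product of $n$-gons* is a polytope $P=\{x\in\mathbb{R}^{2r}: Ax\le d\}$ of the following kind. The matrix $A\in\mathbb{R}^{rn\times 2r}$ consists of $r\times r$ blocks of size $n\times 2$, with the same block $V$ in all diagonal positions, the same block $W$ in all positions directly below the diagonal, the same block $U$ in all positions directly below those, and zeros elsewhere. The rows of $V\in\mathbb{R}^{n\times 2}$ are nonzero, are listed in cyclic order and positively span $\mathbb{R}^2$; for some positive $b\in\mathbb{R}^n$ the system $Vx\le b$ describes a convex $n$-gon $P_n$; and there is an isomorphism $\varphi$ from the face lattice of $(P_n)^r$ to the face lattice of $P$ that takes the facet of $(P_n)^r$ given by the $k$-th inequality in the $i$-th factor to the facet of $P$ given by the $k$-th inequality of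 the $i$-th block of $Ax\le d$. * The *$n$-gon $2$-faces* of $P$ are the images under $\varphi$ of the faces of $(P_n)^r$ that are products of the whole $n$-gon in one factor with vertices in all the other factors. (For $n=4$ these are not all the $2$-faces of $P$ with four vertices.) * A face $G$ of $P$ is *strictly preserved* by $\pi$ (it *survives* the projection) if $\pi(G)$ is a face of $\pi(P)$, the map $\pi$ is injective on $G$ (so $G$ and $\pi(G)$ are isomorphic), and $P\cap\pi^{-1}(\pi(G))=G$. -/

import Mathlib

open Set Module

/-- A (convex) polytope: the convex hull of a finite set of points. -/
def IsPolytope {E : Type*} [AddCommGroup E] [Module ℝ E] (P : Set E) : Prop :=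
  ∃ s : Finset E, P = convexHull ℝ (s : Set E)

/-- The faces of `P`, ordered by inclusion (the face lattice): the empty set and all sets of
maximizers over `P` of a linear functional. `P` itself is the face given by the functional `0`. -/
abbrev Face {E : Type*} [AddCommGroup E] [Module ℝ E] [TopologicalSpace E] (P : Set E) : Type _ :=
  {F : Set E // IsExposed ℝ P F}

/-- `G` is a `k`-dimensional (in particular nonempty) face of `P`. -/
structure IsFaceOfDim {E : Type*} [AddCommGroup E] [Module ℝ E] [TopologicalSpace E]
    (P : Set E) (k : ℕ) (G : Set E) : Prop where
  face : IsExposed ℝ P G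
  nonempty : G.Nonempty
  dim : finrank ℝ (vectorSpan ℝ G) = k

/-- A convex `n`-gon in the plane: a two-dimensional polytope with exactly `n` vertices. -/
structure IsNGon (n : ℕ) (Q : Set (Fin 2 → ℝ)) : Prop where
  polytope : IsPolytope Q
  dim : finrank ℝ (vectorSpan ℝ Q) = 2
  vertices : (Q.exposedPoints ℝ).ncard = n

/-- The face `G` of `P` survives the projection `π`, i.e. it is strictly preserved: the image of
`G` is a face of the image of `P`, `π` maps `G` isomorphically (being linear and injective on `G`)
onto its image, and no other points of `P` are mapped to that image. -/
structure StrictlyPreserved {E E' : Type*} [AddCommGroup E] [Module ℝ E]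
    [AddCommGroup E'] [Module ℝ E'] [TopologicalSpace E']
    (π : E →ₗ[ℝ] E') (P G : Set E) : Prop where
  image_face : IsExposed ℝ (π '' P) (π '' G)
  injOn : InjOn π G
  preimage : P ∩ π ⁻¹' (π '' G) = G

/-- The set of solutions of the system of linear inequalities `A x ≤ b`. -/
def polyhedron {ι κ : Type*} [Fintype κ] (A : Matrix ι κ ℝ) (b : ι → ℝ) : Set (κ → ℝ) :=
  {x | ∀ i, (A.mulVec x) i ≤ b i}

/-- The rows of `V` are nonzero vectors in the plane, listed in cyclic (counterclockwise) order of
their directions, and they positively span the plane. -/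
structure IsPolygonMatrix {n : ℕ} (V : Matrix (Fin n) (Fin 2) ℝ) : Prop where
  cyclic : ∃ ρ θ : Fin n → ℝ, (∀ k, 0 < ρ k) ∧ StrictMono θ ∧
    (∀ k l, θ l < θ k + 2 * Real.pi) ∧
    ∀ k, V k 0 = ρ k * Real.cos (θ k) ∧ V k 1 = ρ k * Real.sin (θ k)
  posSpan : ∀ y : Fin 2 → ℝ, ∃ c : Fin n → ℝ, (∀ k, 0 ≤ c k) ∧ y = ∑ k, c k • V k

/-- The lower block-triangular matrix of size `rn × 2r` with blocks of size `n × 2`: `V` on the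
diagonal, `W` directly below the diagonal, `U` directly below `W`, and zeros elsewhere. Row
`(i, k)` is the `k`-th row of the `i`-th block of rows; the `j`-th block of columns consists of the
coordinates `2j` and `2j + 1` (counted from `0`). -/
def deformedMatrix (r : ℕ) {n : ℕ} (V W U : Matrix (Fin n) (Fin 2) ℝ) :
    Matrix (Fin r × Fin n) (Fin (2 * r)) ℝ :=
  fun p c =>
    let j : ℕ := c.val / 2
    let s : Fin 2 := ⟨c.val % 2, Nat.mod_lt _ two_pos⟩
    if p.1.val = j then V p.2 s
    else if p.1.val = j + 1 then W p.2 s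
    else if p.1.val = j + 2 then U p.2 s
    else 0

/-- The `r`-fold (orthogonal) product `Q × ⋯ × Q`. -/
def productPower (r : ℕ) (Q : Set (Fin 2 → ℝ)) : Set (Fin r → Fin 2 → ℝ) :=
  {y | ∀ i, y i ∈ Q}

/-- `F` is a polygon `2`-face of the `r`-fold product of the polygon `Q`: the product of the whole
polygon `Q` in one factor `t` with vertices `v i` of `Q` in all the other factors. -/
def IsPolygonFace {r : ℕ} (Q : Set (Fin 2 → ℝ)) (F : Set (Fin r → Fin 2 → ℝ)) : Prop :=
  ∃ (t : Fin r) (v : Fin r → Fin 2 → ℝ), (∀ i, i ≠ t → v i ∈ Q.exposedPoints ℝ) ∧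
    F = {y | y t ∈ Q ∧ ∀ i, i ≠ t → y i = v i}

/-- `φ` is a combinatorial equivalence (isomorphism of face lattices) from the product of polygons
`(V x ≤ b)^r` to the polytope `A x ≤ d`, matching the facet of the product given by the `k`-th
inequality in the `i`-th factor with the facet given by the inequality `(i, k)` of `A x ≤ d`. -/
def MatchesFacets {r n : ℕ} (V : Matrix (Fin n) (Fin 2) ℝ) (b : Fin n → ℝ)
    (A : Matrix (Fin r × Fin n) (Fin (2 * r)) ℝ) (d : Fin r × Fin n → ℝ)
    (φ : Face (productPower r (polyhedron V b)) ≃o Face (polyhedron A d)) : Prop :=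
  ∀ (i : Fin r) (k : Fin n) (F : Face (productPower r (polyhedron V b))),
    F.1 = {y ∈ productPower r (polyhedron V b) | (V.mulVec (y i)) k = b k} →
      (φ F).1 = {x ∈ polyhedron A d | (A.mulVec x) (i, k) = d (i, k)}

/-- The projection of `ℝ^m` to the last `k` coordinates. -/
def lastCoords {m k : ℕ} (h : k ≤ m) : (Fin m → ℝ) →ₗ[ℝ] (Fin k → ℝ) :=
  LinearMap.funLeft ℝ ℝ (fun j : Fin k => (⟨m - k + j.val, by omega⟩ : Fin m))

/-! Combinatorics. The face lattice of a polyhedron is determined by the family of its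
simultaneously tight sets of inequalities (`faceOrderIso`). For the block triangular system take the
right-hand side `R ^ i * b` in block `i`. Once the earlier blocks of variables are fixed, block `i`
describes a polygon with normals `V` whose right-hand side is, after scaling by `R ^ i`, a small
perturbation of `b` when `R` is large. Hence every block has the combinatorics of the `n`-gon,
whatever the earlier blocks are, and the tight sets are those of the product
(`exists_deformedProduct`).

Survival. A face survives the projection if the normals tight on it, restricted to the kernel,
satisfy a positive linear relation and have no common zero there: the relation yields a functional
that factors through the projection and is maximal exactly on the face. It suffices that some of the
tight normals do this (`strictlyPreserved_activeFace`). On a vertex, an edge or an `n`-gon face, two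
consecutive inequalities are tight in every block except possibly one block `t`, so only these pairs
of rows are used.

No common zero. Below `t` one eliminates variables from the front through the blocks `V`; above `t`
one eliminates from the back through the blocks `U` (`eq_zero_of_rows`).

Positive relation. As `n` is even, a consecutive pair has one even and one odd row, so the
alternating matrices `W` and `U` contribute the same two rows whatever pair is chosen; the pairs
from `V` vary but are all nearly horizontal. The coefficients `α j`, `β j` satisfy a two-step
recursion. In coordinates with `α = ξ + 2η`, `β = 2ξ + η`, the block `U` acts as `-300` times the
identity and `W` as `300` times the matrix with rows `(3, -1)` and `(1, 0)`, while `V` is a bounded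
perturbation. A solution that is zero at `t` and positive elsewhere is glued from a chain running
into zero and a chain leaving zero (`exists_positive_dependency`); each stays in a cone where both
coefficients are positive. -/

/-! ### Faces of polyhedra in terms of tight inequalities -/

section Halfspaces

variable {E ι : Type*} [AddCommGroup E] [Module ℝ E] [TopologicalSpace E]

/-- The polyhedron cut out by finitely many linear inequalities `a i x ≤ b i`. -/
def halfspaces (a : ι → E →L[ℝ] ℝ) (b : ι → ℝ) : Set E := {x | ∀ i, a i x ≤ b i}

/-- The inequalities that hold with equality at `x`. -/
def activeSet (a : ι → E →L[ℝ] ℝ) (b : ι → ℝ) (x : E) : Set ι := {i | a i x = b i}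

/-- The points of the polyhedron at which all inequalities in `S` are tight. -/
def activeFace (a : ι → E →L[ℝ] ℝ) (b : ι → ℝ) (S : Set ι) : Set E :=
  {x | x ∈ halfspaces a b ∧ S ⊆ activeSet a b x}

/-- The inequalities that are tight on all of `F`. -/
def commonActive (a : ι → E →L[ℝ] ℝ) (b : ι → ℝ) (F : Set E) : Set ι :=
  {i | ∀ y ∈ F, a i y = b i}

variable {a : ι → E →L[ℝ] ℝ} {b : ι → ℝ}

theorem convex_halfspaces : Convex ℝ (halfspaces a b) := by
  intro x hx y hy s t hs ht hst i
  simp only [map_add, map_smul, smul_eq_mul]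
  have h1 := mul_le_mul_of_nonneg_left (hx i) hs
  have h2 := mul_le_mul_of_nonneg_left (hy i) ht
  calc _ ≤ s * b i + t * b i := add_le_add h1 h2
    _ = b i := by rw [← add_mul, hst, one_mul]

theorem midpoint_mem_halfspaces {x y : E} (hx : x ∈ halfspaces a b) (hy : y ∈ halfspaces a b) :
    midpoint ℝ x y ∈ halfspaces a b :=
  convex_halfspaces.midpoint_mem hx hy

theorem activeSet_midpoint {x y : E} (hx : x ∈ halfspaces a b) (hy : y ∈ halfspaces a b) :
    activeSet a b (midpoint ℝ x y) = activeSet a b x ∩ activeSet a b y := by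
  ext i
  have h1 := hx i
  have h2 := hy i
  have h : a i (midpoint ℝ x y) = (a i x + a i y) / 2 := by
    rw [midpoint_eq_smul_add]
    simp only [map_smul, map_add, smul_eq_mul, invOf_eq_inv]
    ring
  simp only [activeSet, mem_ofPred_eq, mem_inter_iff, h]
  constructor
  · intro h3
    constructor <;> linarith
  · rintro ⟨h3, h4⟩
    linarith

/-- From a point of the polyhedron one can move a little in every direction along which the tight
inequalities stay constant. -/
theorem exists_pos_add_smul_mem [Finite ι] {x v : E} (hx : x ∈ halfspaces a b)
    (hv : ∀ i ∈ activeSet a b x, a i v = 0) : ∃ t : ℝ, 0 < t ∧ x + t • v ∈ halfspaces a b := by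
  have h : ∀ i, ∀ᶠ t : ℝ in nhdsWithin 0 (Ioi 0), a i (x + t • v) ≤ b i := by
    intro i
    simp only [map_add, map_smul, smul_eq_mul]
    by_cases hi : i ∈ activeSet a b x
    · simp only [hv i hi, mul_zero, add_zero]
      exact Filter.Eventually.of_forall fun _ => hx i
    · have hlt : a i x < b i := lt_of_le_of_ne (hx i) hi
      have hc : Filter.Tendsto (fun t : ℝ => a i x + t * a i v) (nhdsWithin 0 (Ioi 0))
          (nhds (a i x)) := by
        have : Continuous fun t : ℝ => a i x + t * a i v := by fun_prop
        simpa using (this.tendsto 0).mono_left nhdsWithin_le_nhds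
      exact (hc.eventually (gt_mem_nhds hlt)).mono fun _ h => h.le
  obtain ⟨t, ht, ht0⟩ := ((Filter.eventually_all.2 h).and self_mem_nhdsWithin).exists
  exact ⟨t, ht0, ht⟩

/-- A nonempty exposed face consists of all points satisfying the inequalities that are tight at
one of its points. -/
theorem IsExposed.exists_eq_activeFace [Finite ι] {F : Set E} (hF : IsExposed ℝ (halfspaces a b) F)
    (hne : F.Nonempty) : ∃ x ∈ F, F = activeFace a b (activeSet a b x) := by
  obtain ⟨l, rfl⟩ := hF hne
  set F := {x ∈ halfspaces a b | ∀ y ∈ halfspaces a b, l y ≤ l x} with hFdef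
  -- A point with minimal tight set lies in the relative interior of the face: averaging with any
  -- other point of the face cannot shrink this set further.
  obtain ⟨S, ⟨x, hx, rfl⟩, hmin⟩ := (Set.toFinite (activeSet a b '' F)).exists_minimal (hne.image _)
  refine ⟨x, hx, Subset.antisymm ?_ ?_⟩
  · intro y hy
    refine ⟨hy.1, ?_⟩
    have hm : midpoint ℝ x y ∈ F := by
      refine ⟨midpoint_mem_halfspaces hx.1 hy.1, fun z hz => ?_⟩
      have h : l (midpoint ℝ x y) = (l x + l y) / 2 := by
        rw [midpoint_eq_smul_add]
        simp only [map_smul, map_add, smul_eq_mul, invOf_eq_inv]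
        ring
      rw [h]
      linarith [hx.2 z hz, hy.2 z hz]
    have h := hmin ⟨_, hm, rfl⟩
    rw [activeSet_midpoint hx.1 hy.1] at h
    exact (h inter_subset_left).trans inter_subset_right
  · rintro y ⟨hy, hxy⟩
    refine ⟨hy, fun z hz => (hx.2 z hz).trans ?_⟩
    -- Moving from `x` slightly away from `y` stays in the polyhedron, so maximality at `x` forces
    -- `l y ≥ l x`.
    obtain ⟨t, ht, htm⟩ := exists_pos_add_smul_mem (v := x - y) hx.1 (fun i hi => by
      have h1 : a i x = b i := hi
      have h2 : a i y = b i := hxy hi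
      rw [map_sub, h1, h2, sub_self])
    have h := hx.2 _ htm
    simp only [map_add, map_smul, map_sub, smul_eq_mul] at h
    nlinarith

/-- A nonnegative combination of the inequalities, positive exactly on `S`, is maximized over the
polyhedron exactly where the inequalities in `S` are tight. -/
theorem activeFace_eq_argmax [Fintype ι] {S : Set ι} (hne : (activeFace a b S).Nonempty)
    (c : ι → ℝ) (hc : ∀ i ∈ S, 0 < c i) (hc0 : ∀ i ∉ S, c i = 0) :
    activeFace a b S = {x ∈ halfspaces a b | ∀ y ∈ halfspaces a b,
      ∑ i, c i * a i y ≤ ∑ i, c i * a i x} := by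
  have hcn : ∀ i, 0 ≤ c i := fun i => by
    by_cases hi : i ∈ S
    · exact (hc i hi).le
    · exact (hc0 i hi).ge
  have hle : ∀ y ∈ halfspaces a b, ∀ i, c i * a i y ≤ c i * b i := fun y hy i =>
    mul_le_mul_of_nonneg_left (hy i) (hcn i)
  have heq : ∀ x ∈ activeFace a b S, ∀ i, c i * a i x = c i * b i := by
    intro x hx i
    by_cases hi : i ∈ S
    · rw [show a i x = b i from hx.2 hi]
    · simp [hc0 i hi]
  ext x
  constructor
  · intro hx
    refine ⟨hx.1, fun y hy => Finset.sum_le_sum fun i _ => ?_⟩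
    rw [heq x hx i]
    exact hle y hy i
  · rintro ⟨hx, hmax⟩
    refine ⟨hx, fun i hi => ?_⟩
    obtain ⟨z, hz⟩ := hne
    have h1 := hmax z hz.1
    rw [Finset.sum_congr rfl fun i _ => heq z hz i] at h1
    have h2 := (Finset.sum_eq_sum_iff_of_le fun i _ => hle x hx i).1
      (le_antisymm (Finset.sum_le_sum fun i _ => hle x hx i) h1) i (Finset.mem_univ i)
    exact mul_left_cancel₀ (hc i hi).ne' h2

theorem isExposed_activeFace [Finite ι] [IsTopologicalAddGroup E] [ContinuousSMul ℝ E]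
    (S : Set ι) : IsExposed ℝ (halfspaces a b) (activeFace a b S) := by
  classical
  cases nonempty_fintype ι
  intro hne
  refine ⟨∑ i, (if i ∈ S then (1 : ℝ) else 0) • a i, ?_⟩
  rw [activeFace_eq_argmax hne (fun i => if i ∈ S then 1 else 0) (fun i hi => by simp [hi])
    (fun i hi => by simp [hi])]
  simp only [_root_.sum_apply, _root_.smul_apply, smul_eq_mul]

theorem commonActive_anti {F G : Set E} (h : F ⊆ G) : commonActive a b G ⊆ commonActive a b F :=
  fun _ hi y hy => hi y (h hy)

theorem activeFace_anti {S T : Set ι} (h : S ⊆ T) : activeFace a b T ⊆ activeFace a b S :=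
  fun _ hx => ⟨hx.1, h.trans hx.2⟩

theorem commonActive_activeFace {x : E} (hx : x ∈ halfspaces a b) :
    commonActive a b (activeFace a b (activeSet a b x)) = activeSet a b x :=
  Subset.antisymm (fun _ hi => hi x ⟨hx, Subset.rfl⟩) fun _ hi _ hy => hy.2 hi

theorem IsExposed.activeFace_commonActive [Finite ι] {F : Set E}
    (hF : IsExposed ℝ (halfspaces a b) F) (huniv : ∀ x ∈ halfspaces a b, activeSet a b x ≠ univ) :
    activeFace a b (commonActive a b F) = F := by
  rcases F.eq_empty_or_nonempty with rfl | hne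
  · refine eq_empty_of_forall_notMem fun x hx => huniv x hx.1 ?_
    exact univ_subset_iff.1 fun i _ => hx.2 (fun y hy => hy.elim)
  · obtain ⟨x, hx, h⟩ := hF.exists_eq_activeFace hne
    rw [h, commonActive_activeFace (hF.subset hx)]

end Halfspaces

/-! ### Isomorphism of face lattices from equal families of tight sets -/

section FaceLattice

variable {E E' ι : Type*} [AddCommGroup E] [Module ℝ E] [TopologicalSpace E]
  [IsTopologicalAddGroup E] [ContinuousSMul ℝ E]
  [AddCommGroup E'] [Module ℝ E'] [TopologicalSpace E']
  [IsTopologicalAddGroup E'] [ContinuousSMul ℝ E'] [Finite ι]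
  {a : ι → E →L[ℝ] ℝ} {b : ι → ℝ} {a' : ι → E' →L[ℝ] ℝ} {b' : ι → ℝ}

omit [IsTopologicalAddGroup E] [ContinuousSMul ℝ E] [IsTopologicalAddGroup E']
  [ContinuousSMul ℝ E'] in
-- This makes the two face maps mutually inverse. A nonempty face is encoded by the tight set of a
-- relative interior point, which is also a tight set of the other polyhedron. The empty face is
-- encoded by `univ`; `huniv` ensures that no point has this code.
theorem commonActive_transfer
    (h : activeSet a b '' halfspaces a b ⊆ activeSet a' b' '' halfspaces a' b')
    (huniv : ∀ x ∈ halfspaces a' b', activeSet a' b' x ≠ univ)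
    {F : Set E} (hF : IsExposed ℝ (halfspaces a b) F) :
    commonActive a' b' (activeFace a' b' (commonActive a b F)) = commonActive a b F := by
  rcases F.eq_empty_or_nonempty with rfl | hne
  · have h0 : commonActive a b (∅ : Set E) = univ := by simp [commonActive]
    have h1 : activeFace a' b' univ = ∅ :=
      eq_empty_of_forall_notMem fun x hx => huniv x hx.1 (univ_subset_iff.1 hx.2)
    rw [h0, h1]
    simp [commonActive]
  · obtain ⟨x, hx, hFx⟩ := hF.exists_eq_activeFace hne
    have hxP := hF.subset hx
    obtain ⟨x', hx', hact⟩ := h ⟨x, hxP, rfl⟩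
    rw [hFx, commonActive_activeFace hxP, ← hact, commonActive_activeFace hx']

/-- Two polyhedra with the same possible sets of tight inequalities have isomorphic face
lattices. -/
noncomputable def faceOrderIso
    (h : activeSet a b '' halfspaces a b = activeSet a' b' '' halfspaces a' b')
    (huniv : ∀ x ∈ halfspaces a b, activeSet a b x ≠ univ)
    (huniv' : ∀ x ∈ halfspaces a' b', activeSet a' b' x ≠ univ) :
    Face (halfspaces a b) ≃o Face (halfspaces a' b') :=
  Equiv.toOrderIso
    { toFun := fun F => ⟨activeFace a' b' (commonActive a b F.1), isExposed_activeFace _⟩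
      invFun := fun F => ⟨activeFace a b (commonActive a' b' F.1), isExposed_activeFace _⟩
      left_inv := fun F => Subtype.ext (by
        simp only [commonActive_transfer h.subset huniv' F.2]
        exact F.2.activeFace_commonActive huniv)
      right_inv := fun F => Subtype.ext (by
        simp only [commonActive_transfer h.symm.subset huniv F.2]
        exact F.2.activeFace_commonActive huniv') }
    (fun _ _ hFG => activeFace_anti (commonActive_anti hFG))
    (fun _ _ hFG => activeFace_anti (commonActive_anti hFG))

theorem exists_faceOrderIso {P : Set E} {P' : Set E'} (hP : P = halfspaces a b)
    (hP' : P' = halfspaces a' b')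
    (h : activeSet a b '' halfspaces a b = activeSet a' b' '' halfspaces a' b')
    (huniv : ∀ x ∈ halfspaces a b, activeSet a b x ≠ univ)
    (huniv' : ∀ x ∈ halfspaces a' b', activeSet a' b' x ≠ univ) :
    ∃ φ : Face P ≃o Face P',
      ∀ F, (φ F).1 = activeFace a' b' (commonActive a b F.1) := by
  subst hP hP'
  exact ⟨faceOrderIso h huniv huniv', fun _ => rfl⟩

omit [IsTopologicalAddGroup E] [ContinuousSMul ℝ E] [IsTopologicalAddGroup E']
  [ContinuousSMul ℝ E'] [Finite ι] in
-- More inequalities than `i` may be tight on the first set. They cause no loss: a point where `i`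
-- is tight has a partner in the first polyhedron with the same tight set, and this partner lies in
-- that set.
theorem activeFace_commonActive_facet
    (h : activeSet a b '' halfspaces a b = activeSet a' b' '' halfspaces a' b') (i : ι) :
    activeFace a' b' (commonActive a b {y ∈ halfspaces a b | a i y = b i}) =
      {x ∈ halfspaces a' b' | a' i x = b' i} := by
  ext x
  constructor
  · rintro ⟨hx, hsub⟩
    exact ⟨hx, hsub fun y hy => hy.2⟩
  · rintro ⟨hx, hi⟩
    refine ⟨hx, ?_⟩
    obtain ⟨y, hy, hact⟩ := h.symm.subset ⟨x, hx, rfl⟩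
    rw [← hact]
    have : i ∈ activeSet a b y := by rw [hact]; exact hi
    exact fun j hj => hj y ⟨hy, this⟩

end FaceLattice

/-! ### Bounded polyhedra are polytopes; dimension of faces -/

section Polytope

variable {E ι : Type*} [NormedAddCommGroup E] [NormedSpace ℝ E] [FiniteDimensional ℝ E] [Finite ι]
  {a : ι → E →L[ℝ] ℝ} {b : ι → ℝ}

omit [FiniteDimensional ℝ E] [Finite ι] in
theorem isClosed_halfspaces : IsClosed (halfspaces a b) := by
  simp only [halfspaces, ofPred_forall]
  exact isClosed_iInter fun i => isClosed_le (a i).continuous continuous_const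

omit [FiniteDimensional ℝ E] in
theorem finite_extremePoints_halfspaces : ((halfspaces a b).extremePoints ℝ).Finite := by
  refine Set.Finite.of_finite_image (f := activeSet a b) (Set.toFinite _) ?_
  intro x hx y hy hxy
  have hv : ∀ i ∈ activeSet a b x, a i (x - y) = 0 := fun i hi => by
    have h1 : a i x = b i := hi
    have h2 : a i y = b i := by rw [hxy] at hi; exact hi
    rw [map_sub, h1, h2, sub_self]
  obtain ⟨t, ht, htm⟩ := exists_pos_add_smul_mem hx.1 hv
  by_contra hne
  refine hne ?_
  -- If two extreme points had the same tight set, one could prolong the segment from `y` beyond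
  -- `x`, so `x` would not be extreme.
  have hseg : x ∈ openSegment ℝ y (x + t • (x - y)) := by
    refine ⟨t / (1 + t), 1 / (1 + t), by positivity, by positivity, by field_simp; ring, ?_⟩
    match_scalars
    · field_simp
      ring
    · field_simp
  exact (hx.2 hy.1 htm hseg).symm

/-- A bounded polyhedron is a polytope. -/
theorem isPolytope_halfspaces (hb : Bornology.IsBounded (halfspaces a b)) :
    IsPolytope (halfspaces a b) := by
  have hfin := finite_extremePoints_halfspaces (a := a) (b := b)
  refine ⟨hfin.toFinset, ?_⟩
  rw [Finite.coe_toFinset, ← (hfin.isClosed_convexHull (𝕜 := ℝ)).closure_eq]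
  exact (closure_convexHull_extremePoints
    (Metric.isCompact_of_isClosed_isBounded isClosed_halfspaces hb) convex_halfspaces).symm

/-- The codimension of a face is at most the number of inequalities tight on it. -/
theorem finrank_le_finrank_vectorSpan_activeFace_add {x : E} (hx : x ∈ halfspaces a b) :
    finrank ℝ E ≤ finrank ℝ (vectorSpan ℝ (activeFace a b (activeSet a b x))) +
      (activeSet a b x).ncard := by
  classical
  cases nonempty_fintype ι
  let T : E →ₗ[ℝ] (activeSet a b x → ℝ) := LinearMap.pi fun i => (a i.1).toLinearMap
  have hker : LinearMap.ker T ≤ vectorSpan ℝ (activeFace a b (activeSet a b x)) := by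
    intro v hv
    have hv' : ∀ i ∈ activeSet a b x, a i v = 0 := fun i hi => congrFun hv ⟨i, hi⟩
    obtain ⟨t, ht, htm⟩ := exists_pos_add_smul_mem hx hv'
    have h1 : x + t • v ∈ activeFace a b (activeSet a b x) := by
      refine ⟨htm, fun i hi => ?_⟩
      have : a i (x + t • v) = b i := by
        rw [map_add, map_smul, hv' i hi, smul_zero, add_zero]
        exact hi
      exact this
    have h2 := vsub_mem_vectorSpan ℝ h1 (⟨hx, Subset.rfl⟩ : x ∈ activeFace a b (activeSet a b x))
    have h3 := Submodule.smul_mem _ t⁻¹ h2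
    simpa [smul_smul, ht.ne'] using h3
  have h1 := T.finrank_range_add_finrank_ker
  have h2 := Submodule.finrank_mono hker
  have h3 : finrank ℝ (LinearMap.range T) ≤ (activeSet a b x).ncard := by
    refine (Submodule.finrank_le _).trans ?_
    rw [finrank_fintype_fun_eq_card, Set.ncard_eq_toFinset_card', Set.toFinset_card]
  omega

end Polytope

/-! ### A criterion for surviving a projection -/

section Projection

variable {E E' ι : Type*} [NormedAddCommGroup E] [NormedSpace ℝ E]
  [NormedAddCommGroup E'] [NormedSpace ℝ E'] [FiniteDimensional ℝ E'] [Fintype ι]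
  {a : ι → E →L[ℝ] ℝ} {b : ι → ℝ}

/-- The weighted sum of the inequalities is maximal exactly on the face and factors through `π` as
`l`. So `l` exposes the image, and a point of the polyhedron lying over the image attains the same
maximum, hence belongs to the face. -/
theorem strictlyPreserved_of_functional {π : E →ₗ[ℝ] E'} {S : Set ι}
    (hne : (activeFace a b S).Nonempty) (c : ι → ℝ) (hc : ∀ i ∈ S, 0 < c i)
    (hc0 : ∀ i ∉ S, c i = 0) (l : E' →ₗ[ℝ] ℝ) (hl : ∀ x, ∑ i, c i * a i x = l (π x))
    (hinj : ∀ v, (∀ i ∈ S, a i v = 0) → π v = 0 → v = 0) :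
    StrictlyPreserved π (halfspaces a b) (activeFace a b S) := by
  have hmax := activeFace_eq_argmax hne c hc hc0
  simp only [hl] at hmax
  refine ⟨fun _ => ⟨LinearMap.toContinuousLinearMap l, ?_⟩, ?_, ?_⟩
  · ext z
    constructor
    · rintro ⟨x, hx, rfl⟩
      refine ⟨⟨x, hx.1, rfl⟩, ?_⟩
      rintro _ ⟨y, hy, rfl⟩
      rw [hmax] at hx
      exact hx.2 y hy
    · rintro ⟨⟨x, hx, rfl⟩, h⟩
      refine ⟨x, ?_, rfl⟩
      rw [hmax]
      exact ⟨hx, fun y hy => h _ ⟨y, hy, rfl⟩⟩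
  · intro x hx y hy hxy
    refine sub_eq_zero.1 (hinj _ (fun i hi => ?_) (by rw [map_sub, hxy, sub_self]))
    rw [map_sub, show a i x = b i from hx.2 hi, show a i y = b i from hy.2 hi, sub_self]
  · ext x
    constructor
    · rintro ⟨hx, y, hy, hxy⟩
      rw [hmax] at hy ⊢
      refine ⟨hx, fun z hz => ?_⟩
      rw [← hxy]
      exact hy.2 z hz
    · intro hx
      exact ⟨hx.1, x, hx, rfl⟩

/-- If the inequalities in `S₀ ⊆ S` have a positive linear combination that vanishes on the kernel
of the projection, and no nonzero vector of this kernel is annihilated by all of them, then the face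
given by `S` survives the projection. -/
theorem strictlyPreserved_activeFace {π : E →ₗ[ℝ] E'} {S₀ S : Set ι}
    (hS : S₀ ⊆ S) (hne : (activeFace a b S).Nonempty) (c : ι → ℝ) (hc : ∀ i ∈ S₀, 0 < c i)
    (hc0 : ∀ i ∉ S₀, c i = 0) (hker : ∀ x, π x = 0 → ∑ i, c i * a i x = 0)
    (hinj : ∀ v, (∀ i ∈ S₀, a i v = 0) → π v = 0 → v = 0) :
    StrictlyPreserved π (halfspaces a b) (activeFace a b S) := by
  classical
  let K := LinearMap.ker π
  let w : K →ₗ[ℝ] ℝ := ∑ i, (if i ∈ S ∧ i ∉ S₀ then (1 : ℝ) else 0) •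
    ((a i).toLinearMap ∘ₗ K.subtype)
  let L : S₀ → K →ₗ[ℝ] ℝ := fun i => (a i.1).toLinearMap ∘ₗ K.subtype
  -- On the kernel the functionals from `S₀` have no common zero but `0`, so they span its dual; in
  -- particular they express the sum `w` of the remaining functionals of `S`.
  have hw : w ∈ Submodule.span ℝ (Set.range L) := by
    refine mem_span_of_iInf_ker_le_ker fun v hv => ?_
    have : v = 0 := by
      refine Subtype.ext (hinj v.1 (fun i hi => ?_) v.2)
      exact (Submodule.mem_iInf _).1 hv ⟨i, hi⟩
    rw [this]
    exact Submodule.zero_mem _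
  obtain ⟨e, he⟩ := (Submodule.mem_span_range_iff_exists_fun ℝ).1 hw
  let e' : ι → ℝ := fun i => if h : i ∈ S₀ then e ⟨i, h⟩ else 0
  have he' : ∀ x, π x = 0 → ∑ i, e' i * a i x =
      ∑ i, (if i ∈ S ∧ i ∉ S₀ then (1 : ℝ) else 0) * a i x := by
    intro x hx
    have h := LinearMap.congr_fun he ⟨x, hx⟩
    simp only [L, w, LinearMap.sum_apply, LinearMap.smul_apply, LinearMap.comp_apply, smul_eq_mul,
      Submodule.subtype_apply, ContinuousLinearMap.coe_coe] at h
    rw [← h, ← Finset.sum_subset (Finset.subset_univ (Finset.univ.filter (· ∈ S₀)))]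
    · rw [← Finset.sum_subtype_eq_sum_filter]
      simp [e']
    · intro i _ hi
      have : i ∉ S₀ := by simpa using hi
      simp [e', this]
  obtain ⟨T, hT⟩ : ∃ T : ℝ, ∀ i ∈ S₀, e' i < T * c i := by
    have h : ∀ i, ∃ T : ℝ, 0 ≤ T ∧ (i ∈ S₀ → e' i < T * c i) := fun i => by
      by_cases hi : i ∈ S₀
      · refine ⟨(|e' i| + 1) / c i, ?_, fun _ => ?_⟩
        · exact div_nonneg (by positivity) (hc i hi).le
        · rw [div_mul_cancel₀ _ (hc i hi).ne']
          linarith [le_abs_self (e' i)]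
      · exact ⟨0, le_rfl, fun h => (hi h).elim⟩
    choose T hT0 hT using h
    refine ⟨∑ i, T i, fun i hi => (hT i hi).trans_le ?_⟩
    exact mul_le_mul_of_nonneg_right
      (Finset.single_le_sum (fun j _ => hT0 j) (Finset.mem_univ i)) (hc i hi).le
  -- A large multiple of the given relation absorbs the signs of `e'`: these weights are positive on
  -- all of `S` and still give a sum vanishing on the kernel.
  let c' : ι → ℝ := fun i => T * c i - e' i + if i ∈ S ∧ i ∉ S₀ then (1 : ℝ) else 0
  let f : E →ₗ[ℝ] ℝ := ∑ i, c' i • (a i).toLinearMap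
  have hf : ∀ x, f x = ∑ i, c' i * a i x := fun x => by simp [f]
  have hfk : f ∈ (LinearMap.ker π).dualAnnihilator := by
    rw [Submodule.mem_dualAnnihilator]
    intro x hx
    rw [hf]
    simp only [c', add_mul, sub_mul, Finset.sum_add_distrib, Finset.sum_sub_distrib, mul_assoc,
      ← Finset.mul_sum]
    rw [hker x hx, he' x hx]
    ring
  rw [← LinearMap.range_dualMap_eq_dualAnnihilator_ker] at hfk
  obtain ⟨l, hl⟩ := hfk
  refine strictlyPreserved_of_functional hne c' ?_ ?_ l (fun x => ?_)
    (fun v hv => hinj v fun i hi => hv i (hS hi))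
  · intro i hi
    by_cases hi0 : i ∈ S₀
    · simp only [c', hi0, not_true, and_false, if_false]
      linarith [hT i hi0]
    · simp [c', hi0, hi, e', hc0 i hi0]
  · intro i hi
    have hi0 : i ∉ S₀ := fun h => hi (hS h)
    simp [c', hi0, hi, e', hc0 i hi0]
  · rw [← hf, ← hl]
    rfl

end Projection

/-! ### Rows of a matrix as functionals -/

section RowFunctional

variable {ι κ : Type*} [Fintype κ]

/-- The linear functional given by a row of a matrix. -/
noncomputable def rowFunctional (A : Matrix ι κ ℝ) (i : ι) : (κ → ℝ) →L[ℝ] ℝ :=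
  LinearMap.toContinuousLinearMap ((LinearMap.proj i).comp A.mulVecLin)

theorem rowFunctional_apply (A : Matrix ι κ ℝ) (i : ι) (x : κ → ℝ) :
    rowFunctional A i x = A.mulVec x i := rfl

theorem polyhedron_eq_halfspaces (A : Matrix ι κ ℝ) (b : ι → ℝ) :
    polyhedron A b = halfspaces (rowFunctional A) b := rfl

end RowFunctional

/-! ### Cyclic order on `Fin n` -/

section Cyclic

variable {n : ℕ}

/-- The cyclic successor on `Fin n`. -/
def cyclicSucc (k : Fin n) : Fin n :=
  if h : k.val + 1 < n then ⟨k.val + 1, h⟩ else ⟨0, k.pos⟩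

/-- The cyclic predecessor on `Fin n`. -/
def cyclicPred (k : Fin n) : Fin n :=
  if k.val = 0 then ⟨n - 1, Nat.sub_lt k.pos one_pos⟩ else ⟨k.val - 1, by omega⟩

theorem cyclicSucc_val (k : Fin n) :
    (cyclicSucc k).val = if k.val + 1 < n then k.val + 1 else 0 := by
  unfold cyclicSucc
  split_ifs <;> rfl

theorem cyclicPred_val (k : Fin n) :
    (cyclicPred k).val = if k.val = 0 then n - 1 else k.val - 1 := by
  unfold cyclicPred
  split_ifs <;> rfl

theorem cyclicSucc_cyclicPred (k : Fin n) : cyclicSucc (cyclicPred k) = k := by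
  ext
  rw [cyclicSucc_val, cyclicPred_val]
  have := k.isLt
  split_ifs <;> omega

end Cyclic

/-! ### Combinatorics of a polygon and its stability -/

section Polygon

variable {n : ℕ}

/-- The system `V x ≤ b` describes a polygon whose consecutive inequalities (in cyclic order) meet
in a vertex where all other inequalities are strict. -/
def HasCyclicVertices (V : Matrix (Fin n) (Fin 2) ℝ) (b : Fin n → ℝ) : Prop :=
  ∀ k, ∃ z : Fin 2 → ℝ, V.mulVec z k = b k ∧ V.mulVec z (cyclicSucc k) = b (cyclicSucc k) ∧
    ∀ l, l ≠ k → l ≠ cyclicSucc k → V.mulVec z l < b l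

/-- Cyclically consecutive rows are linearly independent. -/
def ConsecutiveIndependent (V : Matrix (Fin n) (Fin 2) ℝ) : Prop :=
  ∀ k, V k 0 * V (cyclicSucc k) 1 - V k 1 * V (cyclicSucc k) 0 ≠ 0

/-- The sets of inequalities of an `n`-gon that can be tight simultaneously. -/
def polygonActiveSets (n : ℕ) : Set (Set (Fin n)) :=
  {S | S = ∅ ∨ (∃ k, S = {k}) ∨ ∃ k, S = {k, cyclicSucc k}}

theorem mulVec_fin_two (V : Matrix (Fin n) (Fin 2) ℝ) (x : Fin 2 → ℝ) (k : Fin n) :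
    V.mulVec x k = V k 0 * x 0 + V k 1 * x 1 := by
  simp [Matrix.mulVec, dotProduct, Fin.sum_univ_two]

theorem eq_zero_of_consecutive {V : Matrix (Fin n) (Fin 2) ℝ} (hV : ConsecutiveIndependent V)
    {k : Fin n} {x : Fin 2 → ℝ} (h1 : V.mulVec x k = 0) (h2 : V.mulVec x (cyclicSucc k) = 0) :
    x = 0 := by
  rw [mulVec_fin_two] at h1 h2
  have hd := hV k
  have e0 : x 0 = 0 := by
    refine (mul_eq_zero.1 (?_ : (V k 0 * V (cyclicSucc k) 1 - V k 1 * V (cyclicSucc k) 0) * x 0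
      = 0)).resolve_left hd
    linear_combination V (cyclicSucc k) 1 * h1 - V k 1 * h2
  have e1 : x 1 = 0 := by
    refine (mul_eq_zero.1 (?_ : (V k 0 * V (cyclicSucc k) 1 - V k 1 * V (cyclicSucc k) 0) * x 1
      = 0)).resolve_left hd
    linear_combination V k 0 * h2 - V (cyclicSucc k) 0 * h1
  ext i
  fin_cases i
  · exact e0
  · exact e1

variable {V : Matrix (Fin n) (Fin 2) ℝ} {b : Fin n → ℝ}

/-- A feasible point on the line of the `k`-th inequality lies on the segment between the two
vertices on that line. -/
theorem exists_segment_parameter (hV : ConsecutiveIndependent V)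
    {k : Fin n} {z z' x : Fin 2 → ℝ}
    (hz : V.mulVec z k = b k) (hz1 : V.mulVec z (cyclicSucc k) = b (cyclicSucc k))
    (hz2 : V.mulVec z (cyclicPred k) < b (cyclicPred k))
    (hz' : V.mulVec z' k = b k) (hz'1 : V.mulVec z' (cyclicPred k) = b (cyclicPred k))
    (hz'2 : V.mulVec z' (cyclicSucc k) < b (cyclicSucc k))
    (hx : x ∈ polyhedron V b) (hxk : V.mulVec x k = b k) :
    ∃ t : ℝ, 0 ≤ t ∧ t ≤ 1 ∧ ∀ l, V.mulVec x l = (1 - t) * V.mulVec z l + t * V.mulVec z' l := by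
  set A := V.mulVec z' (cyclicSucc k) - b (cyclicSucc k) with hA
  have hA0 : A < 0 := by linarith
  set t := (V.mulVec x (cyclicSucc k) - b (cyclicSucc k)) / A with ht
  have htA : t * A = V.mulVec x (cyclicSucc k) - b (cyclicSucc k) := div_mul_cancel₀ _ hA0.ne
  -- The parameter `t` is chosen so that both points agree on rows `k` and `cyclicSucc k`, which
  -- determine a point of the plane.
  have hv : x - ((1 - t) • z + t • z') = 0 := by
    refine eq_zero_of_consecutive hV (k := k) ?_ ?_
    · simp only [Matrix.mulVec_sub, Matrix.mulVec_add, Matrix.mulVec_smul, Pi.sub_apply,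
        Pi.add_apply, Pi.smul_apply, smul_eq_mul, hz, hz', hxk]
      ring
    · simp only [Matrix.mulVec_sub, Matrix.mulVec_add, Matrix.mulVec_smul, Pi.sub_apply,
        Pi.add_apply, Pi.smul_apply, smul_eq_mul, hz1]
      rw [hA] at htA
      linarith
  have hlin : ∀ l, V.mulVec x l = (1 - t) * V.mulVec z l + t * V.mulVec z' l := by
    intro l
    rw [sub_eq_zero.1 hv]
    simp only [Matrix.mulVec_add, Matrix.mulVec_smul, Pi.add_apply, Pi.smul_apply, smul_eq_mul]
  refine ⟨t, div_nonneg_of_nonpos (by linarith [hx (cyclicSucc k)]) hA0.le, ?_, hlin⟩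
  have h1 := hlin (cyclicPred k)
  have h2 := hx (cyclicPred k)
  rw [h1, hz'1] at h2
  by_contra! hlt
  nlinarith

/-- A point with row `k` tight is a convex combination of the two vertices on that line. At the ends
the tight set is that of the vertex; strictly between them, every other row is strict at one of the
two vertices, hence strict. -/
theorem activeSet_of_tight (hn : 4 ≤ n) (hV : ConsecutiveIndependent V)
    (hb : HasCyclicVertices V b) {x : Fin 2 → ℝ} (hx : x ∈ polyhedron V b) {k : Fin n}
    (hxk : V.mulVec x k = b k) :
    activeSet (rowFunctional V) b x = {k} ∨
    activeSet (rowFunctional V) b x = {k, cyclicSucc k} ∨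
    activeSet (rowFunctional V) b x = {cyclicPred k, k} := by
  obtain ⟨z, hz, hz1, hz2⟩ := hb k
  obtain ⟨z', hz', hz'1, hz'2⟩ := hb (cyclicPred k)
  rw [cyclicSucc_cyclicPred] at hz'1 hz'2
  have hps : cyclicPred k ≠ cyclicSucc k := by
    rw [Ne, Fin.ext_iff, cyclicPred_val, cyclicSucc_val]
    have := k.isLt
    split_ifs <;> omega
  have hpk : cyclicPred k ≠ k := by
    rw [Ne, Fin.ext_iff, cyclicPred_val]
    have := k.isLt
    split_ifs <;> omega
  have hsk : cyclicSucc k ≠ k := by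
    rw [Ne, Fin.ext_iff, cyclicSucc_val]
    have := k.isLt
    split_ifs <;> omega
  obtain ⟨t, ht0, ht1, hlin⟩ := exists_segment_parameter hV hz hz1 (hz2 _ hpk hps)
    hz'1 hz' (hz'2 _ hps.symm hsk) hx hxk
  simp only [activeSet, rowFunctional_apply, hlin]
  rcases ht0.eq_or_lt with rfl | ht0
  · right; left
    ext l
    simp only [mem_ofPred_eq, mem_insert_iff, mem_singleton_iff, sub_zero, one_mul, zero_mul,
      add_zero]
    constructor
    · intro h
      by_contra! hne
      exact (hz2 l hne.1 hne.2).ne h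
    · rintro (rfl | rfl) <;> assumption
  rcases ht1.eq_or_lt with rfl | ht1
  · right; right
    ext l
    simp only [mem_ofPred_eq, mem_insert_iff, mem_singleton_iff, sub_self, one_mul, zero_mul,
      zero_add]
    constructor
    · intro h
      by_contra! hne
      exact (hz'2 l hne.1 hne.2).ne h
    · rintro (rfl | rfl) <;> assumption
  · left
    ext l
    simp only [mem_ofPred_eq, mem_singleton_iff]
    constructor
    · intro h
      by_contra hlk
      have h1 : V.mulVec z l ≤ b l := by
        by_cases h' : l = cyclicSucc k
        · rw [h', hz1]
        · exact (hz2 l hlk h').le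
      have h2 : V.mulVec z' l ≤ b l := by
        by_cases h' : l = cyclicPred k
        · rw [h', hz']
        · exact (hz'2 l h' hlk).le
      by_cases h' : l = cyclicSucc k
      · have h3 := hz'2 l (by rw [h']; exact hps.symm) hlk
        nlinarith
      · have h3 := hz2 l hlk h'
        nlinarith
    · rintro rfl
      rw [hz, hz'1]
      ring

theorem vertex_mem {k : Fin n} {z : Fin 2 → ℝ}
    (h : V.mulVec z k = b k ∧ V.mulVec z (cyclicSucc k) = b (cyclicSucc k) ∧
      ∀ l, l ≠ k → l ≠ cyclicSucc k → V.mulVec z l < b l) :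
    z ∈ halfspaces (rowFunctional V) b ∧
      activeSet (rowFunctional V) b z = {k, cyclicSucc k} := by
  constructor
  · intro l
    rw [rowFunctional_apply]
    by_cases h1 : l = k
    · rw [h1, h.1]
    by_cases h2 : l = cyclicSucc k
    · rw [h2, h.2.1]
    exact (h.2.2 l h1 h2).le
  · ext l
    simp only [activeSet, mem_ofPred_eq, rowFunctional_apply, mem_insert_iff, mem_singleton_iff]
    constructor
    · intro h'
      by_contra! hne
      exact (h.2.2 l hne.1 hne.2).ne h'
    · rintro (rfl | rfl)
      exacts [h.1, h.2.1]

theorem activeSet_image_polygon (hn : 4 ≤ n) (hV : ConsecutiveIndependent V)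
    (hb : HasCyclicVertices V b) :
    activeSet (rowFunctional V) b '' halfspaces (rowFunctional V) b = polygonActiveSets n := by
  apply Subset.antisymm
  · rintro _ ⟨x, hx, rfl⟩
    rcases (activeSet (rowFunctional V) b x).eq_empty_or_nonempty with h | ⟨k, hk⟩
    · exact Or.inl h
    · rcases activeSet_of_tight hn hV hb hx hk with h | h | h
      · exact Or.inr (Or.inl ⟨k, h⟩)
      · exact Or.inr (Or.inr ⟨k, h⟩)
      · refine Or.inr (Or.inr ⟨cyclicPred k, ?_⟩)
        rw [cyclicSucc_cyclicPred, h]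
  · choose z hz using hb
    have hP := fun k => (vertex_mem (hz k)).1
    have hA := fun k => (vertex_mem (hz k)).2
    rintro S (rfl | ⟨k, rfl⟩ | ⟨k, rfl⟩)
    -- Tight sets of midpoints are intersections. The pairs `{0, 1}` and `{2, cyclicSucc 2}` are
    -- disjoint because `n ≥ 4`.
    · refine ⟨midpoint ℝ (z ⟨0, by omega⟩) (z ⟨2, by omega⟩),
        midpoint_mem_halfspaces (hP _) (hP _), ?_⟩
      rw [activeSet_midpoint (hP _) (hP _), hA, hA]
      ext l
      simp only [mem_inter_iff, mem_insert_iff, mem_singleton_iff, Fin.ext_iff, cyclicSucc_val,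
        mem_empty_iff_false, iff_false]
      split_ifs <;> omega
    · refine ⟨midpoint ℝ (z (cyclicPred k)) (z k), midpoint_mem_halfspaces (hP _) (hP _), ?_⟩
      rw [activeSet_midpoint (hP _) (hP _), hA, hA, cyclicSucc_cyclicPred]
      ext l
      simp only [mem_inter_iff, mem_insert_iff, mem_singleton_iff, Fin.ext_iff, cyclicSucc_val,
        cyclicPred_val]
      have := k.isLt
      split_ifs <;> omega
    · exact ⟨z k, hP k, hA k⟩

theorem cyclic_pair_injective (hn : 3 ≤ n) :
    Function.Injective fun k : Fin n => ({k, cyclicSucc k} : Set (Fin n)) := by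
  intro k l h
  have h1 : k ∈ ({l, cyclicSucc l} : Set (Fin n)) := by
    rw [← show _ = ({l, cyclicSucc l} : Set (Fin n)) from h]; simp
  have h2 : cyclicSucc k ∈ ({l, cyclicSucc l} : Set (Fin n)) := by
    rw [← show _ = ({l, cyclicSucc l} : Set (Fin n)) from h]; simp
  simp only [mem_insert_iff, mem_singleton_iff, Fin.ext_iff, cyclicSucc_val] at h1 h2
  have hk := k.isLt
  have hl := l.isLt
  ext
  rcases h1 with h1 | h1
  · exact h1
  rcases h2 with h2 | h2 <;> split_ifs at h1 h2 <;> omega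

/-- At a vertex exactly two consecutive inequalities are tight. -/
theorem exists_activeSet_eq_of_mem_exposedPoints (hn : 4 ≤ n) (hV : ConsecutiveIndependent V)
    (hb : HasCyclicVertices V b) {x : Fin 2 → ℝ} (hx : x ∈ (polyhedron V b).exposedPoints ℝ) :
    ∃ k, activeSet (rowFunctional V) b x = {k, cyclicSucc k} := by
  have hxP : x ∈ halfspaces (rowFunctional V) b := exposedPoints_subset hx
  rw [mem_exposedPoints_iff_exposed_singleton, polyhedron_eq_halfspaces] at hx
  obtain ⟨y, hy, hface⟩ := hx.exists_eq_activeFace (singleton_nonempty x)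
  rw [mem_singleton_iff] at hy
  subst hy
  have himg := activeSet_image_polygon hn hV hb
  have hmem : activeSet (rowFunctional V) b y ∈ polygonActiveSets n := by
    rw [← himg]
    exact ⟨y, hxP, rfl⟩
  -- No other point has all the inequalities tight at `y` tight. This excludes the tight sets `∅`
  -- and `{k}`, each properly contained in another realizable one.
  have huniq : ∀ w ∈ halfspaces (rowFunctional V) b,
      activeSet (rowFunctional V) b y ⊆ activeSet (rowFunctional V) b w → w = y := by
    intro w hw hsub
    have : w ∈ ({y} : Set (Fin 2 → ℝ)) := by
      rw [hface]
      exact ⟨hw, hsub⟩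
    exact this
  have hpair : ∀ k : Fin n, k ∈ ({k, cyclicSucc k} : Set (Fin n)) := fun k => by simp
  rcases hmem with h | ⟨k, h⟩ | h
  · exfalso
    obtain ⟨w, hw, hwS⟩ := himg.symm.subset
      (Or.inr (Or.inl ⟨⟨0, by omega⟩, rfl⟩) : {(⟨0, by omega⟩ : Fin n)} ∈ polygonActiveSets n)
    have h1 := huniq w hw (by rw [h]; exact empty_subset _)
    rw [h1, h] at hwS
    exact (singleton_ne_empty _ hwS.symm)
  · exfalso
    obtain ⟨w, hw, hwS⟩ := himg.symm.subset
      (Or.inr (Or.inr ⟨k, rfl⟩) : {k, cyclicSucc k} ∈ polygonActiveSets n)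
    have h1 := huniq w hw (by rw [h, hwS]; simp)
    rw [h1, h] at hwS
    have h2 : cyclicSucc k ∈ ({k} : Set (Fin n)) := by rw [hwS]; simp
    rw [mem_singleton_iff, Fin.ext_iff, cyclicSucc_val] at h2
    have := k.isLt
    split_ifs at h2 <;> omega
  · exact h

theorem mem_exposedPoints_of_activeSet (hV : ConsecutiveIndependent V) {x : Fin 2 → ℝ}
    (hx : x ∈ polyhedron V b) {k : Fin n}
    (hk : activeSet (rowFunctional V) b x = {k, cyclicSucc k}) :
    x ∈ (polyhedron V b).exposedPoints ℝ := by
  rw [mem_exposedPoints_iff_exposed_singleton]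
  have h : activeFace (rowFunctional V) b {k, cyclicSucc k} = {x} := by
    apply Subset.antisymm
    · rintro y ⟨_, hsub⟩
      have hx' : ({k, cyclicSucc k} : Set (Fin n)) ⊆ activeSet (rowFunctional V) b x := hk.ge
      have e : ∀ l ∈ ({k, cyclicSucc k} : Set (Fin n)), V.mulVec (y - x) l = 0 := by
        intro l hl
        have h1 : V.mulVec y l = b l := hsub hl
        have h2 : V.mulVec x l = b l := hx' hl
        rw [Matrix.mulVec_sub, Pi.sub_apply, h1, h2, sub_self]
      exact sub_eq_zero.1 (eq_zero_of_consecutive hV (e k (by simp)) (e (cyclicSucc k) (by simp)))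
    · rintro y rfl
      exact ⟨hx, hk.ge⟩
  rw [← h]
  exact isExposed_activeFace _

theorem ncard_exposedPoints_polygon (hn : 4 ≤ n) (hV : ConsecutiveIndependent V)
    (hb : HasCyclicVertices V b) : ((polyhedron V b).exposedPoints ℝ).ncard = n := by
  have hb' := hb
  choose z hz using hb
  have hinj : Function.Injective z := by
    intro k l hkl
    have h1 := (vertex_mem (hz k)).2
    rw [hkl, (vertex_mem (hz l)).2] at h1
    exact (cyclic_pair_injective (by omega) h1).symm
  have hrange : (polyhedron V b).exposedPoints ℝ = range z := by
    apply Subset.antisymm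
    · intro x hx
      obtain ⟨k, hk⟩ := exists_activeSet_eq_of_mem_exposedPoints hn hV hb' hx
      refine ⟨k, ?_⟩
      have h1 : V.mulVec x k = b k := hk.ge (by simp : k ∈ ({k, cyclicSucc k} : Set (Fin n)))
      have h2 : V.mulVec x (cyclicSucc k) = b (cyclicSucc k) :=
        hk.ge (by simp : cyclicSucc k ∈ ({k, cyclicSucc k} : Set (Fin n)))
      refine sub_eq_zero.1 (eq_zero_of_consecutive hV (k := k) ?_ ?_)
      · rw [Matrix.mulVec_sub, Pi.sub_apply, (hz k).1, h1, sub_self]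
      · rw [Matrix.mulVec_sub, Pi.sub_apply, (hz k).2.1, h2, sub_self]
    · rintro _ ⟨k, rfl⟩
      exact mem_exposedPoints_of_activeSet hV (vertex_mem (hz k)).1 (vertex_mem (hz k)).2
  rw [hrange, ← image_univ, ncard_image_of_injective _ hinj, ncard_univ, Nat.card_eq_fintype_card,
    Fintype.card_fin]

/-- A matrix with positively spanning rows describes polygons that are bounded uniformly in the
right-hand side. -/
theorem exists_bound_of_posSpan
    (hspan : ∀ y : Fin 2 → ℝ, ∃ c : Fin n → ℝ, (∀ k, 0 ≤ c k) ∧ y = ∑ k, c k • V k) :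
    ∃ C : ℝ, 0 ≤ C ∧ ∀ (b' : Fin n → ℝ) (B : ℝ), (∀ k, b' k ≤ B) → 0 ≤ B →
      ∀ x ∈ polyhedron V b', ∀ s, |x s| ≤ C * B := by
  have h : ∀ y : Fin 2 → ℝ, ∃ C : ℝ, 0 ≤ C ∧ ∀ (b' : Fin n → ℝ) (B : ℝ), (∀ k, b' k ≤ B) →
      0 ≤ B → ∀ x ∈ polyhedron V b', y 0 * x 0 + y 1 * x 1 ≤ C * B := by
    intro y
    obtain ⟨c, hc, rfl⟩ := hspan y
    refine ⟨∑ k, c k, Finset.sum_nonneg fun k _ => hc k, fun b' B hb' hB x hx => ?_⟩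
    rw [Finset.sum_apply, Finset.sum_apply, Finset.sum_mul, Finset.sum_mul, Finset.sum_mul,
      ← Finset.sum_add_distrib]
    refine Finset.sum_le_sum fun k _ => ?_
    have h1 := (hx k).trans (hb' k)
    rw [mulVec_fin_two] at h1
    have := mul_le_mul_of_nonneg_left h1 (hc k)
    simp only [Pi.smul_apply, smul_eq_mul]
    linarith
  -- The directions `±e₀`, `±e₁` bound both coordinates from both sides.
  obtain ⟨C1, hC1, h1⟩ := h ![1, 0]
  obtain ⟨C2, hC2, h2⟩ := h ![-1, 0]
  obtain ⟨C3, hC3, h3⟩ := h ![0, 1]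
  obtain ⟨C4, hC4, h4⟩ := h ![0, -1]
  refine ⟨C1 + C2 + C3 + C4, by positivity, fun b' B hb' hB x hx s => ?_⟩
  have e1 := h1 b' B hb' hB x hx
  have e2 := h2 b' B hb' hB x hx
  have e3 := h3 b' B hb' hB x hx
  have e4 := h4 b' B hb' hB x hx
  simp at e1 e2 e3 e4
  have p1 := mul_nonneg hC1 hB
  have p2 := mul_nonneg hC2 hB
  have p3 := mul_nonneg hC3 hB
  have p4 := mul_nonneg hC4 hB
  rw [abs_le]
  fin_cases s <;> constructor <;> simp <;> linarith

theorem isBounded_of_abs_le {κ : Type*} [Fintype κ] {P : Set (κ → ℝ)} {C : ℝ}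
    (h : ∀ x ∈ P, ∀ i, |x i| ≤ C) : Bornology.IsBounded P := by
  refine (isBounded_iff_forall_norm_le).2 ⟨max C 0, fun x hx => ?_⟩
  rw [pi_norm_le_iff_of_nonneg (le_max_right _ _)]
  exact fun i => (h x hx i).trans (le_max_left _ _)

theorem isNGon_polyhedron (hn : 4 ≤ n) (hV : ConsecutiveIndependent V)
    (hb : HasCyclicVertices V b)
    (hspan : ∀ y : Fin 2 → ℝ, ∃ c : Fin n → ℝ, (∀ k, 0 ≤ c k) ∧ y = ∑ k, c k • V k) :
    IsNGon n (polyhedron V b) where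
  polytope := by
    obtain ⟨C, -, hC⟩ := exists_bound_of_posSpan hspan
    rw [polyhedron_eq_halfspaces]
    refine isPolytope_halfspaces (isBounded_of_abs_le fun x hx =>
      hC b (∑ k, |b k|) (fun k => ?_) (Finset.sum_nonneg fun _ _ => abs_nonneg _) x hx)
    exact (le_abs_self _).trans
      (Finset.single_le_sum (f := fun k => |b k|) (fun _ _ => abs_nonneg _) (Finset.mem_univ k))
  dim := by
    obtain ⟨x, hx, hact⟩ := (activeSet_image_polygon hn hV hb).symm.subset
      (Or.inl rfl : ∅ ∈ polygonActiveSets n)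
    have h := finrank_le_finrank_vectorSpan_activeFace_add hx
    have hface : activeFace (rowFunctional V) b (activeSet (rowFunctional V) b x) =
        polyhedron V b := by
      rw [hact]
      ext y
      exact ⟨fun h => h.1, fun h => ⟨h, empty_subset _⟩⟩
    rw [hface, hact, ncard_empty, finrank_fintype_fun_eq_card, Fintype.card_fin] at h
    have h2 := Submodule.finrank_le (vectorSpan ℝ (polyhedron V b))
    rw [finrank_fintype_fun_eq_card, Fintype.card_fin] at h2
    omega
  vertices := ncard_exposedPoints_polygon hn hV hb

/-- The intersection of the lines of two consecutive inequalities, by Cramer's rule. -/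
noncomputable def cramerVertex (V : Matrix (Fin n) (Fin 2) ℝ) (k : Fin n) (b : Fin n → ℝ) :
    Fin 2 → ℝ :=
  ![(b k * V (cyclicSucc k) 1 - V k 1 * b (cyclicSucc k)) /
      (V k 0 * V (cyclicSucc k) 1 - V k 1 * V (cyclicSucc k) 0),
    (V k 0 * b (cyclicSucc k) - b k * V (cyclicSucc k) 0) /
      (V k 0 * V (cyclicSucc k) 1 - V k 1 * V (cyclicSucc k) 0)]

/-- The vertices are forced, by independence, to be the Cramer solutions, which depend continuously
on `b`. The condition thus becomes finitely many strict inequalities, so it is open in `b`. -/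
theorem hasCyclicVertices_iff (hV : ConsecutiveIndependent V) :
    HasCyclicVertices V b ↔
      ∀ k l, l ≠ k → l ≠ cyclicSucc k → V.mulVec (cramerVertex V k b) l < b l := by
  have hc : ∀ k, V.mulVec (cramerVertex V k b) k = b k ∧
      V.mulVec (cramerVertex V k b) (cyclicSucc k) = b (cyclicSucc k) := by
    intro k
    have hd := hV k
    simp only [mulVec_fin_two, cramerVertex, Matrix.cons_val_zero, Matrix.cons_val_one]
    constructor
    · rw [← mul_div_assoc, ← mul_div_assoc, ← add_div, div_eq_iff hd]
      ring
    · rw [← mul_div_assoc, ← mul_div_assoc, ← add_div, div_eq_iff hd]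
      ring
  constructor
  · intro hb k l h1 h2
    obtain ⟨z, hz, hz1, hz2⟩ := hb k
    have : z = cramerVertex V k b := by
      refine sub_eq_zero.1 (eq_zero_of_consecutive hV (k := k) ?_ ?_)
      · rw [Matrix.mulVec_sub, Pi.sub_apply, (hc k).1, hz, sub_self]
      · rw [Matrix.mulVec_sub, Pi.sub_apply, (hc k).2, hz1, sub_self]
    rw [← this]
    exact hz2 l h1 h2
  · exact fun h k => ⟨_, (hc k).1, (hc k).2, fun l h1 h2 => h k l h1 h2⟩

theorem isOpen_hasCyclicVertices (hV : ConsecutiveIndependent V) :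
    IsOpen {b | HasCyclicVertices V b} := by
  simp only [hasCyclicVertices_iff hV, ofPred_forall]
  refine isOpen_iInter_of_finite fun k => isOpen_iInter_of_finite fun l =>
    isOpen_iInter_of_finite fun _ => isOpen_iInter_of_finite fun _ => ?_
  simp only [mulVec_fin_two, cramerVertex, Matrix.cons_val_zero, Matrix.cons_val_one]
  exact isOpen_lt (by fun_prop) (by fun_prop)

theorem HasCyclicVertices.smul (hb : HasCyclicVertices V b) {τ : ℝ} (hτ : 0 < τ) :
    HasCyclicVertices V (τ • b) := by
  intro k
  obtain ⟨z, hz, hz1, hz2⟩ := hb k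
  refine ⟨τ • z, ?_, ?_, fun l h1 h2 => ?_⟩ <;>
    simp only [Matrix.mulVec_smul, Pi.smul_apply, smul_eq_mul]
  · rw [hz]
  · rw [hz1]
  · exact mul_lt_mul_of_pos_left (hz2 l h1 h2) hτ

/-- The combinatorics of the polygon is stable under small perturbations of the right-hand side,
uniformly under scaling. -/
theorem HasCyclicVertices.stable (hV : ConsecutiveIndependent V) (hb : HasCyclicVertices V b) :
    ∃ δ : ℝ, 0 < δ ∧ ∀ (τ : ℝ) (b' : Fin n → ℝ), 0 < τ → (∀ k, |b' k - τ * b k| ≤ τ * δ) →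
      HasCyclicVertices V b' := by
  obtain ⟨δ, hδ, h⟩ := Metric.isOpen_iff.1 (isOpen_hasCyclicVertices hV) b hb
  refine ⟨δ / 2, by positivity, fun τ b' hτ hb' => ?_⟩
  have h1 : τ⁻¹ • b' ∈ Metric.ball b δ := by
    rw [Metric.mem_ball, dist_eq_norm]
    refine lt_of_le_of_lt ((pi_norm_le_iff_of_nonneg (by positivity)).2 fun k => ?_)
      (half_lt_self hδ)
    have h2 := mul_le_mul_of_nonneg_left (hb' k) (inv_nonneg.2 hτ.le)
    rw [inv_mul_cancel_left₀ hτ.ne'] at h2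
    refine le_trans (le_of_eq ?_) h2
    rw [Real.norm_eq_abs, ← abs_of_pos (inv_pos.2 hτ), ← abs_mul, abs_of_pos (inv_pos.2 hτ),
      Pi.sub_apply, Pi.smul_apply, smul_eq_mul, mul_sub, inv_mul_cancel_left₀ hτ.ne']
  have h3 := (h h1 : HasCyclicVertices V (τ⁻¹ • b')).smul hτ
  rwa [smul_inv_smul₀ hτ.ne'] at h3

end Polygon

/-! ### Block coordinates of the deformed matrix -/

section Blocks

variable {r n : ℕ}

/-- The blocks of two coordinates of `x`, with index shifted by two: blocks `0` and `1` are zero,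
block `j + 2` consists of the coordinates `2j` and `2j + 1`. -/
def shiftedBlock (x : Fin (2 * r) → ℝ) (m : ℕ) : Fin 2 → ℝ :=
  fun s => if h : 2 ≤ m ∧ m - 2 < r then x ⟨2 * (m - 2) + s.val, by omega⟩ else 0

theorem shiftedBlock_of_lt_two (x : Fin (2 * r) → ℝ) {m : ℕ} (hm : m < 2) :
    shiftedBlock x m = 0 := by
  ext s
  simp [shiftedBlock, show ¬ 2 ≤ m by omega]

theorem shiftedBlock_add_two (x : Fin (2 * r) → ℝ) (j : Fin r) (s : Fin 2) :
    shiftedBlock x (j.val + 2) s = x ⟨2 * j.val + s.val, by omega⟩ := by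
  simp [shiftedBlock]

/-- The vector with given (shifted) blocks. -/
def ofShiftedBlocks (r : ℕ) (X : ℕ → Fin 2 → ℝ) : Fin (2 * r) → ℝ :=
  fun c => X (c.val / 2 + 2) ⟨c.val % 2, Nat.mod_lt _ two_pos⟩

theorem shiftedBlock_ofShiftedBlocks {X : ℕ → Fin 2 → ℝ} (h0 : X 0 = 0) (h1 : X 1 = 0) {m : ℕ}
    (hm : m < r + 2) : shiftedBlock (ofShiftedBlocks r X) m = X m := by
  rcases lt_or_ge m 2 with h | h
  · rw [shiftedBlock_of_lt_two _ h]
    interval_cases m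
    · exact h0.symm
    · exact h1.symm
  · obtain ⟨j, rfl⟩ : ∃ j, m = j + 2 := ⟨m - 2, by omega⟩
    ext s
    rw [shiftedBlock_add_two _ ⟨j, by omega⟩]
    have e1 : (2 * j + s.val) / 2 = j := by omega
    have e2 : (2 * j + s.val) % 2 = s.val := by omega
    simp only [ofShiftedBlocks, e1, e2]

theorem eq_zero_of_shiftedBlock {x : Fin (2 * r) → ℝ} (h : ∀ m < r + 2, shiftedBlock x m = 0) :
    x = 0 := by
  ext c
  have h1 := congrFun (h (c.val / 2 + 2) (by omega)) ⟨c.val % 2, Nat.mod_lt _ two_pos⟩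
  rw [shiftedBlock_add_two _ ⟨c.val / 2, by omega⟩] at h1
  refine Eq.trans (congrArg x (Fin.ext ?_)) h1
  simp only
  omega

variable {V W U : Matrix (Fin n) (Fin 2) ℝ}

/-- The two zero blocks put in front make one formula valid for all `i`, including the first two
blocks of rows, where `W` or `U` is absent. -/
theorem deformedMatrix_mulVec (x : Fin (2 * r) → ℝ) (i : Fin r) (k : Fin n) :
    (deformedMatrix r V W U).mulVec x (i, k) =
      V.mulVec (shiftedBlock x (i.val + 2)) k + W.mulVec (shiftedBlock x (i.val + 1)) k +
        U.mulVec (shiftedBlock x i.val) k := by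
  let e : Fin r × Fin 2 ≃ Fin (2 * r) := finProdFinEquiv.trans (finCongr (mul_comm r 2))
  have he : ∀ j s, (e (j, s)).val = s.val + 2 * j.val := fun j s => rfl
  have hblock : ∀ M : Matrix (Fin n) (Fin 2) ℝ, ∀ j : Fin r,
      M.mulVec (shiftedBlock x (j.val + 2)) k = ∑ s, M k s * x (e (j, s)) := by
    intro M j
    rw [Matrix.mulVec, dotProduct]
    refine Finset.sum_congr rfl fun s _ => ?_
    rw [shiftedBlock_add_two]
    congr 2
    ext
    rw [he]
    exact add_comm _ _
  have hshift : ∀ (M : Matrix (Fin n) (Fin 2) ℝ) (m : ℕ), m ≤ 2 →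
      M.mulVec (shiftedBlock x (i.val + 2 - m)) k =
        ∑ j : Fin r, if i.val = j.val + m then M.mulVec (shiftedBlock x (j.val + 2)) k else 0 := by
    intro M m hm
    by_cases h : m ≤ i.val
    · rw [Finset.sum_eq_single (⟨i.val - m, by omega⟩ : Fin r)]
      · rw [if_pos (by simp only; omega)]
        congr 3
        simp only
        omega
      · intro j _ hj
        rw [if_neg]
        intro h'
        refine hj (Fin.ext ?_)
        simp only
        omega
      · simp
    · rw [shiftedBlock_of_lt_two _ (by omega), Matrix.mulVec_zero, Finset.sum_eq_zero]
      · rfl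
      · intro j _
        rw [if_neg (by omega)]
  have h0 := hshift V 0 (by omega)
  have h1 := hshift W 1 (by omega)
  have h2 := hshift U 2 (by omega)
  rw [show i.val + 2 - 0 = i.val + 2 by omega] at h0
  rw [show i.val + 2 - 1 = i.val + 1 by omega] at h1
  rw [show i.val + 2 - 2 = i.val by omega] at h2
  rw [h0, h1, h2, ← Finset.sum_add_distrib, ← Finset.sum_add_distrib]
  simp only [hblock]
  rw [Matrix.mulVec, dotProduct, ← e.sum_comp, Fintype.sum_prod_type]
  refine Finset.sum_congr rfl fun j _ => ?_
  have hd : ∀ s : Fin 2, (s.val + 2 * j.val) / 2 = j.val := fun s => by omega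
  have hm : ∀ s : Fin 2, (s.val + 2 * j.val) % 2 = s.val := fun s => by omega
  simp only [deformedMatrix, he, hd, hm, add_zero]
  by_cases c0 : i.val = j.val
  · have c1 : i.val ≠ j.val + 1 := by omega
    have c2 : i.val ≠ j.val + 2 := by omega
    simp [c0]
  by_cases c1 : i.val = j.val + 1
  · simp [c1]
  by_cases c2 : i.val = j.val + 2
  · simp [c2]
  · simp [c0, c1, c2]

end Blocks

/-! ### The deformed product has the combinatorics of the product -/

section DeformedProduct

variable {r n : ℕ} {V W U : Matrix (Fin n) (Fin 2) ℝ} {b : Fin n → ℝ}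

/-- The right-hand side of the `i`-th block of inequalities, once the previous blocks of variables
are fixed. -/
def blockBound (W U : Matrix (Fin n) (Fin 2) ℝ) (b : Fin n → ℝ) (R : ℝ) (X : ℕ → Fin 2 → ℝ)
    (i : ℕ) : Fin n → ℝ :=
  fun k => R ^ i * b k - W.mulVec (X (i + 1)) k - U.mulVec (X i) k

/-- For rapidly increasing right-hand sides all blocks of inequalities describe polygons with the
same combinatorics. -/
theorem exists_growth_rate (hV : ConsecutiveIndependent V) (hb : HasCyclicVertices V b)
    (hspan : ∀ y : Fin 2 → ℝ, ∃ c : Fin n → ℝ, (∀ k, 0 ≤ c k) ∧ y = ∑ k, c k • V k) :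
    ∃ R C : ℝ, 0 < R ∧ ∀ (X : ℕ → Fin 2 → ℝ) (m : ℕ), X 0 = 0 → X 1 = 0 →
      (∀ i < m, X (i + 2) ∈ polyhedron V (blockBound W U b R X i)) →
      (∀ i ≤ m, HasCyclicVertices V (blockBound W U b R X i)) ∧
      ∀ j < m + 2, ∀ s, R ^ 2 * |X j s| ≤ C * R ^ j := by
  obtain ⟨δ, hδ, hstab⟩ := hb.stable hV
  obtain ⟨C₀, hC₀, hbd⟩ := exists_bound_of_posSpan hspan
  set B := ∑ k, |b k| with hB
  have hB0 : 0 ≤ B := Finset.sum_nonneg fun _ _ => abs_nonneg _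
  have hbB : ∀ k, b k ≤ B := fun k => (le_abs_self _).trans
    (Finset.single_le_sum (f := fun k => |b k|) (fun _ _ => abs_nonneg _) (Finset.mem_univ k))
  -- `C` is fixed before `R`, so `R` may be chosen in terms of it: block `j` has size at most `C * R
  -- ^ (j - 2)`, and the earlier blocks perturb `R ^ i * b` by at most `(KW + KU) * C * R ^ i / R ≤
  -- R ^ i * δ`.
  set C := C₀ * (B + δ) with hC
  have hC0 : 0 ≤ C := by positivity
  have hrow : ∀ M : Matrix (Fin n) (Fin 2) ℝ, ∃ K : ℝ, 0 ≤ K ∧ ∀ (x : Fin 2 → ℝ) (a : ℝ),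
      (∀ s, |x s| ≤ a) → ∀ k, |M.mulVec x k| ≤ K * a := by
    intro M
    refine ⟨∑ k, (|M k 0| + |M k 1|), Finset.sum_nonneg fun _ _ => by positivity,
      fun x a hx k => ?_⟩
    have ha : 0 ≤ a := (abs_nonneg _).trans (hx 0)
    rw [mulVec_fin_two]
    calc |M k 0 * x 0 + M k 1 * x 1| ≤ |M k 0| * |x 0| + |M k 1| * |x 1| := by
          rw [← abs_mul, ← abs_mul]; exact abs_add_le _ _
      _ ≤ |M k 0| * a + |M k 1| * a := by gcongr <;> exact hx _
      _ = (|M k 0| + |M k 1|) * a := by ring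
      _ ≤ _ := mul_le_mul_of_nonneg_right (Finset.single_le_sum
          (f := fun k => |M k 0| + |M k 1|) (fun _ _ => by positivity) (Finset.mem_univ k)) ha
  obtain ⟨KW, hKW, hW⟩ := hrow W
  obtain ⟨KU, hKU, hU⟩ := hrow U
  set R := max 1 ((KW + KU) * C / δ) with hR
  have hR1 : 1 ≤ R := le_max_left _ _
  have hR0 : 0 < R := by linarith
  have hRδ : (KW + KU) * C ≤ R * δ := by
    rw [← div_le_iff₀ hδ]
    exact le_max_right _ _
  have hpert : ∀ (X : ℕ → Fin 2 → ℝ) (i : ℕ), (∀ s, R ^ 2 * |X i s| ≤ C * R ^ i) →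
      (∀ s, R ^ 2 * |X (i + 1) s| ≤ C * R ^ (i + 1)) →
      ∀ k, |blockBound W U b R X i k - R ^ i * b k| ≤ R ^ i * δ := by
    intro X i h0 h1 k
    have e0 : ∀ s, |X i s| ≤ C * R ^ i / R := by
      intro s
      rw [le_div_iff₀ hR0]
      nlinarith [h0 s, abs_nonneg (X i s), mul_nonneg (abs_nonneg (X i s)) hR0.le]
    have e1 : ∀ s, |X (i + 1) s| ≤ C * R ^ i / R := by
      intro s
      rw [le_div_iff₀ hR0]
      have h2 := h1 s
      rw [pow_succ R i] at h2
      refine le_of_mul_le_mul_right (a := R) ?_ hR0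
      linarith
    have e2 := hU _ _ e0 k
    have e3 := hW _ _ e1 k
    have e4 : blockBound W U b R X i k - R ^ i * b k =
        -(W.mulVec (X (i + 1)) k + U.mulVec (X i) k) := by
      unfold blockBound
      ring
    rw [e4, abs_neg]
    refine (abs_add_le _ _).trans ((add_le_add e3 e2).trans ?_)
    have e5 : KW * (C * R ^ i / R) + KU * (C * R ^ i / R) = (KW + KU) * C * R ^ i / R := by ring
    rw [e5, div_le_iff₀ hR0]
    calc (KW + KU) * C * R ^ i ≤ R * δ * R ^ i := by gcongr
      _ = R ^ i * δ * R := by ring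
  refine ⟨R, C, hR0, fun X m hX0 hX1 hX => ?_⟩
  -- The factor `R ^ 2` on the left replaces the exponent `j - 2`, which would be negative for the
  -- two zero blocks.
  have hbound : ∀ j < m + 2, ∀ s, R ^ 2 * |X j s| ≤ C * R ^ j := by
    intro j
    induction j using Nat.strong_induction_on with
    | _ j ih =>
      intro hj s
      rcases lt_or_ge j 2 with h | h
      · have : X j = 0 := by interval_cases j <;> assumption
        rw [this]
        simp only [Pi.zero_apply, abs_zero, mul_zero]
        positivity
      · obtain ⟨i, rfl⟩ : ∃ i, j = i + 2 := ⟨j - 2, by omega⟩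
        have h1 := hpert X i (ih i (by omega) (by omega)) (ih (i + 1) (by omega) (by omega))
        have h2 := hbd _ (R ^ i * (B + δ)) (fun k => ?_) (by positivity) _ (hX i (by omega)) s
        · calc R ^ 2 * |X (i + 2) s| ≤ R ^ 2 * (C₀ * (R ^ i * (B + δ))) := by gcongr
            _ = C * R ^ (i + 2) := by rw [hC]; ring
        · have h3 := (abs_le.1 (h1 k)).2
          have h4 : R ^ i * b k ≤ R ^ i * B := mul_le_mul_of_nonneg_left (hbB k) (by positivity)
          linarith
  exact ⟨fun i hi => hstab (R ^ i) _ (by positivity)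
    (hpert X i (hbound i (by omega)) (hbound (i + 1) (by omega))), hbound⟩

/-- The functionals defining the `r`-fold product of a polygon. -/
noncomputable def productRow (r : ℕ) (V : Matrix (Fin n) (Fin 2) ℝ) (p : Fin r × Fin n) :
    (Fin r → Fin 2 → ℝ) →L[ℝ] ℝ :=
  (rowFunctional V p.2).comp (ContinuousLinearMap.proj p.1)

theorem productPower_eq_halfspaces :
    productPower r (polyhedron V b) = halfspaces (productRow r V) (fun p => b p.2) := by
  ext y
  exact ⟨fun h p => h p.1 p.2, fun h i k => h (i, k)⟩

/-- The sets of inequalities of the product of `r` polygons that can be tight simultaneously. -/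
def productActiveSets (r n : ℕ) : Set (Set (Fin r × Fin n)) :=
  {S | ∀ i, {k | (i, k) ∈ S} ∈ polygonActiveSets n}

theorem activeSet_image_productPower (hn : 4 ≤ n) (hV : ConsecutiveIndependent V)
    (hb : HasCyclicVertices V b) :
    activeSet (productRow r V) (fun p => b p.2) '' halfspaces (productRow r V) (fun p => b p.2) =
      productActiveSets r n := by
  have himg := activeSet_image_polygon hn hV hb
  apply Subset.antisymm
  · rintro _ ⟨y, hy, rfl⟩ i
    rw [← himg]
    exact ⟨y i, fun k => hy (i, k), rfl⟩
  · intro S hS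
    have h : ∀ i, ∃ x ∈ halfspaces (rowFunctional V) b,
        activeSet (rowFunctional V) b x = {k | (i, k) ∈ S} := fun i => by
      have := hS i
      rwa [← himg] at this
    choose y hy hact using h
    refine ⟨y, fun p => hy p.1 p.2, ?_⟩
    ext ⟨i, k⟩
    exact Set.ext_iff.1 (hact i) k

/-- The right-hand side of a deformed product. -/
def deformedBound (r : ℕ) (b : Fin n → ℝ) (R : ℝ) (p : Fin r × Fin n) : ℝ := R ^ p.1.val * b p.2

theorem rowFunctional_deformedMatrix_eq_iff {R : ℝ} (x : Fin (2 * r) → ℝ) (i : Fin r) (k : Fin n) :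
    rowFunctional (deformedMatrix r V W U) (i, k) x = deformedBound r b R (i, k) ↔
      rowFunctional V k (shiftedBlock x (i.val + 2)) =
        blockBound W U b R (shiftedBlock x) i.val k := by
  rw [rowFunctional_apply, rowFunctional_apply, deformedMatrix_mulVec, deformedBound, blockBound]
  constructor <;> intro h <;> linarith

theorem mem_deformed_iff {R : ℝ} (x : Fin (2 * r) → ℝ) :
    x ∈ halfspaces (rowFunctional (deformedMatrix r V W U)) (deformedBound r b R) ↔
      ∀ i < r, shiftedBlock x (i + 2) ∈ polyhedron V (blockBound W U b R (shiftedBlock x) i) := by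
  have e : ∀ (i : Fin r) (k : Fin n),
      rowFunctional (deformedMatrix r V W U) (i, k) x ≤ deformedBound r b R (i, k) ↔
        V.mulVec (shiftedBlock x (i.val + 2)) k ≤
          blockBound W U b R (shiftedBlock x) i.val k := by
    intro i k
    rw [rowFunctional_apply, deformedMatrix_mulVec, deformedBound, blockBound]
    constructor <;> intro h <;> linarith
  constructor
  · intro h i hi k
    exact (e ⟨i, hi⟩ k).1 (h (⟨i, hi⟩, k))
  · rintro h ⟨i, k⟩
    exact (e i k).2 (h i.val i.isLt k)

/-- A deformed product with rapidly increasing right-hand side has the combinatorics of the product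
of polygons, and is bounded. -/
theorem exists_deformedProduct (r : ℕ) (hn : 4 ≤ n) (hV : ConsecutiveIndependent V)
    (hb : HasCyclicVertices V b)
    (hspan : ∀ y : Fin 2 → ℝ, ∃ c : Fin n → ℝ, (∀ k, 0 ≤ c k) ∧ y = ∑ k, c k • V k) :
    ∃ d : Fin r × Fin n → ℝ,
      activeSet (rowFunctional (deformedMatrix r V W U)) d ''
        halfspaces (rowFunctional (deformedMatrix r V W U)) d = productActiveSets r n ∧
      Bornology.IsBounded (halfspaces (rowFunctional (deformedMatrix r V W U)) d) := by
  obtain ⟨R, C, hR, hgrow⟩ := exists_growth_rate (W := W) (U := U) hV hb hspan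
  refine ⟨deformedBound r b R, Subset.antisymm ?_ ?_, ?_⟩
  · rintro _ ⟨x, hx, rfl⟩ i
    rw [mem_deformed_iff] at hx
    obtain ⟨hgood, -⟩ := hgrow (shiftedBlock x) r (shiftedBlock_of_lt_two _ (by omega))
      (shiftedBlock_of_lt_two _ (by omega)) hx
    rw [← activeSet_image_polygon hn hV (hgood i.val i.isLt.le)]
    refine ⟨_, hx i.val i.isLt, ?_⟩
    ext k
    exact (rowFunctional_deformedMatrix_eq_iff x i k).symm
  · intro S hS
    -- A prescribed tight set is realized block by block: whatever the earlier blocks are, the next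
    -- system is an `n`-gon with the standard tight sets.
    have h : ∀ m ≤ r, ∃ X : ℕ → Fin 2 → ℝ, X 0 = 0 ∧ X 1 = 0 ∧
        (∀ i < m, X (i + 2) ∈ polyhedron V (blockBound W U b R X i)) ∧
        ∀ (i : Fin r), i.val < m → activeSet (rowFunctional V) (blockBound W U b R X i)
          (X (i.val + 2)) = {k | (i, k) ∈ S} := by
      intro m
      induction m with
      | zero => exact fun _ => ⟨0, rfl, rfl, fun i hi => by omega, fun i hi => by omega⟩
      | succ m ih =>
        intro hm
        obtain ⟨X, h0, h1, hX, hS'⟩ := ih (by omega)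
        obtain ⟨hgood, -⟩ := hgrow X m h0 h1 hX
        have h2 := hS ⟨m, hm⟩
        rw [← activeSet_image_polygon hn hV (hgood m le_rfl)] at h2
        obtain ⟨w, hw, hwS⟩ := h2
        have hne : ∀ j < m + 2, Function.update X (m + 2) w j = X j := fun j hj =>
          Function.update_of_ne (by omega) _ _
        have hbb : ∀ i ≤ m, blockBound W U b R (Function.update X (m + 2) w) i =
            blockBound W U b R X i := by
          intro i hi
          unfold blockBound
          rw [hne _ (by omega), hne _ (by omega)]
        refine ⟨Function.update X (m + 2) w, by rw [hne _ (by omega), h0],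
          by rw [hne _ (by omega), h1], fun i hi => ?_, fun i hi => ?_⟩
        · rw [hbb i (by omega)]
          rcases Nat.lt_succ_iff_lt_or_eq.1 hi with h | rfl
          · rw [hne _ (by omega)]
            exact hX i h
          · rw [Function.update_self]
            exact hw
        · rw [hbb i (by omega)]
          rcases Nat.lt_succ_iff_lt_or_eq.1 hi with h | h
          · rw [hne _ (by omega)]
            exact hS' i h
          · obtain rfl : i = ⟨m, hm⟩ := Fin.ext h
            rw [Function.update_self]
            exact hwS
    obtain ⟨X, h0, h1, hX, hS'⟩ := h r le_rfl
    have hsb : ∀ m < r + 2, shiftedBlock (ofShiftedBlocks r X) m = X m := fun m hm =>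
      shiftedBlock_ofShiftedBlocks h0 h1 hm
    have hbb : ∀ i < r, blockBound W U b R (shiftedBlock (ofShiftedBlocks r X)) i =
        blockBound W U b R X i := by
      intro i hi
      unfold blockBound
      rw [hsb _ (by omega), hsb _ (by omega)]
    refine ⟨ofShiftedBlocks r X, ?_, ?_⟩
    · rw [mem_deformed_iff]
      intro i hi
      rw [hbb i hi, hsb _ (by omega)]
      exact hX i hi
    · ext ⟨i, k⟩
      refine (rowFunctional_deformedMatrix_eq_iff _ i k).trans ?_
      rw [hbb _ i.isLt, hsb _ (by omega)]
      exact Set.ext_iff.1 (hS' i i.isLt) k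
  · refine isBounded_of_abs_le (C := ∑ j ∈ Finset.range (r + 2), |C * R ^ j| / R ^ 2)
      fun x hx c => ?_
    rw [mem_deformed_iff] at hx
    obtain ⟨-, hbound⟩ := hgrow (shiftedBlock x) r (shiftedBlock_of_lt_two _ (by omega))
      (shiftedBlock_of_lt_two _ (by omega)) hx
    have h1 := hbound (c.val / 2 + 2) (by omega) ⟨c.val % 2, Nat.mod_lt _ two_pos⟩
    rw [shiftedBlock_add_two _ ⟨c.val / 2, by omega⟩] at h1
    have h2 : (⟨2 * (c.val / 2) + c.val % 2, by omega⟩ : Fin (2 * r)) = c := by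
      ext
      simp only
      omega
    simp only [h2] at h1
    have h3 : |x c| ≤ |C * R ^ (c.val / 2 + 2)| / R ^ 2 := by
      rw [le_div_iff₀ (by positivity)]
      linarith [le_abs_self (C * R ^ (c.val / 2 + 2))]
    exact h3.trans (Finset.single_le_sum (f := fun j => |C * R ^ j| / R ^ 2)
      (fun _ _ => by positivity) (Finset.mem_range.2 (by omega)))

end DeformedProduct

/-! ### Positive solutions of the two-step recursion -/

section Chain

theorem abs_mul_le_of_abs_le {p q P Q : ℝ} (hp : |p| ≤ P) (hq : |q| ≤ Q) : |p * q| ≤ P * Q := by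
  rw [abs_mul]
  exact mul_le_mul hp hq (abs_nonneg _) ((abs_nonneg _).trans hp)

/-- The parameters `(g, s, s')` of a pair of rows `(1, s)`, `(g, s')` that are close to a common
line. -/
structure IsFlatPair (ρ : ℝ × ℝ × ℝ) : Prop where
  lower : -(1 / 2) ≤ ρ.1
  upper : ρ.1 ≤ 1
  slope : |ρ.2.1| ≤ 1 / 80
  slope' : |ρ.2.2| ≤ 1 / 80

/-- First coordinate of the combination of `(1, s)` and `(g, s')` with coefficients `x + 2y` and
`2x + y`. -/
def pairFst (ρ : ℝ × ℝ × ℝ) (x y : ℝ) : ℝ := (x + 2 * y) + ρ.1 * (2 * x + y)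

/-- Second coordinate of the combination of `(1, s)` and `(g, s')` with coefficients `x + 2y` and
`2x + y`. -/
def pairSnd (ρ : ℝ × ℝ × ℝ) (x y : ℝ) : ℝ := ρ.2.1 * (x + 2 * y) + ρ.2.2 * (2 * x + y)

/-- In the cone both coefficients are positive, and `ρ.1 ≥ -1/2` gives a first coordinate of at
least `(x + 2y) - (2x + y)/2 = 3y/2`. The second is at most `(3x + 3y)/80`. So the pair map turns a
cone around the second axis into a narrow cone around the first. -/
theorem IsFlatPair.image_cone {ρ : ℝ × ℝ × ℝ} (hρ : IsFlatPair ρ) {x y : ℝ} (hy : 0 < y)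
    (hx : |x| ≤ y / 4) : 0 < pairFst ρ x y ∧ |pairSnd ρ x y| ≤ pairFst ρ x y / 20 := by
  obtain ⟨hx1, hx2⟩ := abs_le.1 hx
  have hβ : 0 < 2 * x + y := by linarith
  have hα : 0 < x + 2 * y := by linarith
  have h1 : -(1 / 2) * (2 * x + y) ≤ ρ.1 * (2 * x + y) :=
    mul_le_mul_of_nonneg_right hρ.lower hβ.le
  have h2 := abs_le.1 (abs_mul_le_of_abs_le hρ.slope (le_of_eq (abs_of_pos hα)))
  have h3 := abs_le.1 (abs_mul_le_of_abs_le hρ.slope' (le_of_eq (abs_of_pos hβ)))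
  have hX : y ≤ pairFst ρ x y := by
    unfold pairFst
    linarith
  refine ⟨by linarith, abs_le.2 ?_⟩
  unfold pairSnd
  constructor <;> linarith [h2.1, h2.2, h3.1, h3.2]

/-- The two-step recursion satisfied by the coefficients of a dependency of the rows. -/
def PairRecursion (ρ : ℝ × ℝ × ℝ) (x₀ y₀ x₁ y₁ x₂ y₂ : ℝ) : Prop :=
  pairFst ρ x₀ y₀ + 300 * (3 * x₁ - y₁) - 300 * x₂ = 0 ∧
    pairSnd ρ x₀ y₀ + 300 * x₁ - 300 * y₂ = 0

/-- Chains that stay in the cone `|x| ≤ y / 4` and then reach zero; the second term depends linearly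
on the first one, through a matrix with small entries. -/
theorem exists_terminating_chain (m : ℕ) : ∀ ρ : ℕ → ℝ × ℝ × ℝ, (∀ j, IsFlatPair (ρ j)) →
    ∃ a b c d : ℝ, |a| ≤ 1 / 20 ∧ |b| ≤ 1 / 20 ∧ |c| ≤ 1 / 20 ∧ |d| ≤ 1 / 20 ∧
      ∀ x y : ℝ, 0 < y → |x| ≤ y / 4 → ∃ ξ η : ℕ → ℝ, ξ 0 = x ∧ η 0 = y ∧
        ξ 1 = a * x + b * y ∧ η 1 = c * x + d * y ∧ ξ (m + 1) = 0 ∧ η (m + 1) = 0 ∧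
        (∀ j ≤ m, 0 < η j ∧ |ξ j| ≤ η j / 4) ∧
        ∀ j < m, PairRecursion (ρ j) (ξ j) (η j) (ξ (j + 1)) (η (j + 1)) (ξ (j + 2)) (η (j + 2)) := by
  induction m with
  | zero =>
    intro ρ _
    refine ⟨0, 0, 0, 0, by norm_num, by norm_num, by norm_num, by norm_num, fun x y hy hx =>
      ⟨fun j => if j = 0 then x else 0, fun j => if j = 0 then y else 0, by simp, by simp, by simp,
        by simp, by simp, by simp, fun j hj => ?_, fun j hj => by omega⟩⟩
    obtain rfl : j = 0 := by omega
    exact ⟨by simpa using hy, by simpa using hx⟩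
  | succ m ih =>
    intro ρ hρ
    obtain ⟨a, b, c, d, ha, hb, hc, hd, h⟩ := ih (fun j => ρ (j + 1)) fun j => hρ (j + 1)
    have hρ0 := hρ 0
    set g := (ρ 0).1 with hg
    set s := (ρ 0).2.1 with hs
    set s' := (ρ 0).2.2 with hs'
    have ha' := abs_le.1 ha
    have hb' := abs_le.1 hb
    have hc' := abs_le.1 hc
    have hd' := abs_le.1 hd
    have hs1 := abs_le.1 hρ0.slope
    have hs2 := abs_le.1 hρ0.slope'
    have hg1 := hρ0.lower
    have hg2 := hρ0.upper
    rw [← hs] at hs1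
    rw [← hs'] at hs2
    rw [← hg] at hg1 hg2
    -- The chain after the first step is known to satisfy `v₂ = T v₁`, where `T` has rows `(a, b)`,
    -- `(c, d)`. With `M` having rows `(3, -1)`, `(1, 0)`, the first recursion step reads `300 (M -
    -- T) v₁ = -(pair map) v₀`, and `D` is the determinant of `M - T`.
    set D := -((3 - a) * d) + (1 + b) * (1 - c) with hD
    have hD1 : 3 / 4 ≤ D := by
      have h1 : |(3 - a) * d| ≤ (61 / 20) * (1 / 20) :=
        abs_mul_le_of_abs_le (abs_le.2 ⟨by linarith, by linarith⟩) hd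
      have h2 : (19 / 20 : ℝ) * (19 / 20) ≤ (1 + b) * (1 - c) :=
        mul_le_mul (by linarith) (by linarith) (by norm_num) (by linarith)
      rw [hD]
      linarith [(abs_le.1 h1).2]
    have hD0 : 0 < D := by linarith
    have hbound : ∀ p q u v : ℝ, |p| ≤ 61 / 20 → |q| ≤ 61 / 20 → |u| ≤ 3 → |v| ≤ 3 / 80 →
        |(p * u - q * v) / (300 * D)| ≤ 1 / 20 := by
      intro p q u v hp hq hu hv
      have h1 := abs_le.1 (abs_mul_le_of_abs_le hp hu)
      have h2 := abs_le.1 (abs_mul_le_of_abs_le hq hv)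
      rw [abs_div, abs_of_pos (by positivity : 0 < 300 * D), div_le_iff₀ (by positivity)]
      exact abs_le.2 ⟨by linarith, by linarith⟩
    -- Entries of `-(M - T)⁻¹ / 300` times the matrix of the pair map; the factor 300 keeps them
    -- below `1/20`.
    refine ⟨(d * (1 + 2 * g) - (1 + b) * (s + 2 * s')) / (300 * D),
      (d * (2 + g) - (1 + b) * (2 * s + s')) / (300 * D),
      ((1 - c) * (1 + 2 * g) - (3 - a) * (s + 2 * s')) / (300 * D),
      ((1 - c) * (2 + g) - (3 - a) * (2 * s + s')) / (300 * D), ?_, ?_, ?_, ?_, ?_⟩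
    · refine hbound _ _ _ _ ?_ ?_ ?_ ?_ <;> exact abs_le.2 ⟨by linarith, by linarith⟩
    · refine hbound _ _ _ _ ?_ ?_ ?_ ?_ <;> exact abs_le.2 ⟨by linarith, by linarith⟩
    · refine hbound _ _ _ _ ?_ ?_ ?_ ?_ <;> exact abs_le.2 ⟨by linarith, by linarith⟩
    · refine hbound _ _ _ _ ?_ ?_ ?_ ?_ <;> exact abs_le.2 ⟨by linarith, by linarith⟩
    intro x y hy hx
    obtain ⟨hX, hY⟩ := hρ0.image_cone hy hx
    set X := pairFst (ρ 0) x y with hXdef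
    set Y := pairSnd (ρ 0) x y with hYdef
    set x₁ := (d * X - (1 + b) * Y) / (300 * D) with hx₁
    set y₁ := ((1 - c) * X - (3 - a) * Y) / (300 * D) with hy₁
    have ex : x₁ * (300 * D) = d * X - (1 + b) * Y := div_mul_cancel₀ _ (by positivity)
    have ey : y₁ * (300 * D) = (1 - c) * X - (3 - a) * Y := div_mul_cancel₀ _ (by positivity)
    have b1 := abs_le.1 (abs_mul_le_of_abs_le hd (le_of_eq (abs_of_pos hX)))
    have b2 := abs_le.1 (abs_mul_le_of_abs_le
      (abs_le.2 ⟨by linarith, by linarith⟩ : |1 + b| ≤ 21 / 20) hY)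
    have b3 := abs_le.1 (abs_mul_le_of_abs_le
      (abs_le.2 ⟨by linarith, by linarith⟩ : |3 - a| ≤ 61 / 20) hY)
    have b4 : 19 / 20 * X ≤ (1 - c) * X := mul_le_mul_of_nonneg_right (by linarith) hX.le
    have hnum : 0 < (1 - c) * X - (3 - a) * Y := by linarith [b3.2]
    have hy₁0 : 0 < y₁ := div_pos hnum (by positivity)
    -- Up to small terms `v₁` is `(-Y, X - 3Y) / 300`, and `|Y| ≤ X / 20`, so the chain is back in
    -- the cone around the second axis.
    have hx₁0 : |x₁| ≤ y₁ / 4 := by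
      rw [hx₁, hy₁, abs_div, abs_of_pos (by positivity : 0 < 300 * D), div_right_comm]
      refine div_le_div_of_nonneg_right ?_ (by positivity)
      exact abs_le.2 ⟨by linarith [b1.1, b1.2, b2.1, b2.2, b3.1, b3.2],
        by linarith [b1.1, b1.2, b2.1, b2.2, b3.1, b3.2]⟩
    obtain ⟨ξ, η, h0, h0', h1, h1', hm, hm', hcone, hchain⟩ := h x₁ y₁ hy₁0 hx₁0
    refine ⟨fun j => if j = 0 then x else ξ (j - 1), fun j => if j = 0 then y else η (j - 1),
      by simp, by simp, ?_, ?_, by simpa using hm, by simpa using hm', ?_, ?_⟩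
    · simp only [one_ne_zero, if_false, Nat.sub_self, h0, hx₁]
      rw [hXdef, hYdef, pairFst, pairSnd, ← hg, ← hs, ← hs']
      field_simp
      ring
    · simp only [one_ne_zero, if_false, Nat.sub_self, h0', hy₁]
      rw [hXdef, hYdef, pairFst, pairSnd, ← hg, ← hs, ← hs']
      field_simp
      ring
    · rintro (_ | j) hj
      · exact ⟨by simpa using hy, by simpa using hx⟩
      · simpa using hcone j (by omega)
    · rintro (_ | j) hj
      · simp only [if_true, zero_add, one_ne_zero, if_false, Nat.sub_self, h0, h0',
          OfNat.ofNat_ne_zero, Nat.add_one_sub_one, h1, h1']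
        constructor
        · rw [← hXdef]
          have : 300 * D * (X + 300 * (3 * x₁ - y₁) - 300 * (a * x₁ + b * y₁)) = 0 := by
            rw [hD] at ex ey ⊢
            linear_combination (300 * (3 - a)) * ex - (300 * (1 + b)) * ey
          exact (mul_eq_zero.1 this).resolve_left (by positivity)
        · rw [← hYdef]
          have : 300 * D * (Y + 300 * x₁ - 300 * (c * x₁ + d * y₁)) = 0 := by
            rw [hD] at ex ey ⊢
            linear_combination (300 * (1 - c)) * ex - (300 * d) * ey
          exact (mul_eq_zero.1 this).resolve_left (by positivity)
      · exact hchain j (by omega)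

/-- Chains that start at zero and then stay in the cone `-x / 4 ≤ y ≤ x`. -/
theorem exists_starting_chain {ρ : ℕ → ℝ × ℝ × ℝ} (hρ : ∀ j, IsFlatPair (ρ j)) {x y : ℝ}
    (hx : 0 < x) (hy : |y| ≤ x / 4) : ∃ ξ η : ℕ → ℝ, ξ 0 = 0 ∧ η 0 = 0 ∧ ξ 1 = x ∧ η 1 = y ∧
      (∀ j, 0 < ξ (j + 1) ∧ -(ξ (j + 1) / 4) ≤ η (j + 1) ∧ η (j + 1) ≤ ξ (j + 1)) ∧
      ∀ j, PairRecursion (ρ j) (ξ j) (η j) (ξ (j + 1)) (η (j + 1)) (ξ (j + 2)) (η (j + 2)) := by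
  obtain ⟨f, hf0, hf⟩ : ∃ f : ℕ → (ℝ × ℝ) × (ℝ × ℝ), f 0 = ((0, 0), (x, y)) ∧
      ∀ j, f (j + 1) = ((f j).2,
        (3 * (f j).2.1 - (f j).2.2 + pairFst (ρ j) (f j).1.1 (f j).1.2 / 300,
          (f j).2.1 + pairSnd (ρ j) (f j).1.1 (f j).1.2 / 300)) :=
    ⟨fun j => Nat.rec ((0, 0), (x, y)) (fun j p => (p.2,
        (3 * p.2.1 - p.2.2 + pairFst (ρ j) p.1.1 p.1.2 / 300,
          p.2.1 + pairSnd (ρ j) p.1.1 p.1.2 / 300))) j, rfl, fun _ => rfl⟩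
  have hy' := abs_le.1 hy
  -- The state holds two consecutive terms. That the first coordinate does not decrease lets the
  -- perturbation coming from the older term be bounded by the newer one.
  have hinv : ∀ j, (0 ≤ (f j).1.1 ∧ (f j).1.1 ≤ (f j).2.1 ∧ -((f j).1.1 / 4) ≤ (f j).1.2 ∧
      (f j).1.2 ≤ (f j).1.1) ∧
      (0 < (f j).2.1 ∧ -((f j).2.1 / 4) ≤ (f j).2.2 ∧ (f j).2.2 ≤ (f j).2.1) := by
    intro j
    induction j with
    | zero =>
      rw [hf0]
      refine ⟨⟨le_rfl, hx.le, by simp, le_rfl⟩, hx, hy'.1, ?_⟩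
      change y ≤ x
      linarith [hy'.2]
    | succ j ih =>
      rw [hf j]
      obtain ⟨⟨h1, h2, h3, h4⟩, h5, h6, h7⟩ := ih
      set u := (f j).1.1
      set v := (f j).1.2
      set x₁ := (f j).2.1
      set y₁ := (f j).2.2
      have hα : |u + 2 * v| ≤ 3 * u := abs_le.2 ⟨by linarith, by linarith⟩
      have hβ : |2 * u + v| ≤ 3 * u := abs_le.2 ⟨by linarith, by linarith⟩
      have b1 := abs_le.1 (abs_mul_le_of_abs_le (abs_le.2 ⟨by linarith [(hρ j).lower], (hρ j).upper⟩
        : |(ρ j).1| ≤ 1) hβ)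
      have b2 := abs_le.1 (abs_mul_le_of_abs_le (hρ j).slope hα)
      have b3 := abs_le.1 (abs_mul_le_of_abs_le (hρ j).slope' hβ)
      have hα' := abs_le.1 hα
      simp only [pairFst, pairSnd]
      refine ⟨⟨h5.le, ?_, h6, h7⟩, ?_, ?_, ?_⟩ <;>
        linarith [b1.1, b1.2, b2.1, b2.2, b3.1, b3.2, hα'.1, hα'.2]
  have hfst : ∀ j, (f (j + 1)).1 = (f j).2 := fun j => by rw [hf]
  refine ⟨fun j => (f j).1.1, fun j => (f j).1.2, by simp [hf0], by simp [hf0],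
    by simp [hfst, hf0], by simp [hfst, hf0], fun j => ?_, fun j => ?_⟩
  · simp only [hfst]
    exact (hinv j).2
  · simp only [hfst]
    rw [hf j]
    constructor <;> ring

/-- For any sequence of flat pairs, the recursion has a solution that is positive except for a
prescribed zero. -/
theorem exists_positive_dependency {ρ : ℕ → ℝ × ℝ × ℝ} (hρ : ∀ j, IsFlatPair (ρ j)) (t : ℕ) :
    ∃ α β : ℕ → ℝ, α t = 0 ∧ β t = 0 ∧ (∀ j, j ≠ t → 0 < α j ∧ 0 < β j) ∧
      ∀ j, α j + (ρ j).1 * β j + (-500 * α (j + 1) + 700 * β (j + 1)) +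
          (100 * α (j + 2) - 200 * β (j + 2)) = 0 ∧
        (ρ j).2.1 * α j + (ρ j).2.2 * β j + (-100 * α (j + 1) + 200 * β (j + 1)) +
          (-200 * α (j + 2) + 100 * β (j + 2)) = 0 := by
  suffices h : ∃ ξ η : ℕ → ℝ, ξ t = 0 ∧ η t = 0 ∧
      (∀ j, j ≠ t → 0 < ξ j + 2 * η j ∧ 0 < 2 * ξ j + η j) ∧
      ∀ j, PairRecursion (ρ j) (ξ j) (η j) (ξ (j + 1)) (η (j + 1)) (ξ (j + 2)) (η (j + 2)) by
    obtain ⟨ξ, η, h1, h2, h3, h4⟩ := h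
    -- In these coordinates the `W` terms become `300 (3ξ - η)` and `300 ξ`, and the `U` terms `-300
    -- ξ` and `-300 η`.
    refine ⟨fun j => ξ j + 2 * η j, fun j => 2 * ξ j + η j, by simp [h1, h2], by simp [h1, h2], h3,
      fun j => ?_⟩
    obtain ⟨h5, h6⟩ := h4 j
    unfold pairFst at h5
    unfold pairSnd at h6
    constructor <;> linarith
  rcases t with _ | m
  · obtain ⟨ξ, η, h0, h0', -, -, hcone, hchain⟩ := exists_starting_chain hρ (x := 1) (y := 0)
      one_pos (by norm_num)
    refine ⟨ξ, η, h0, h0', ?_, hchain⟩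
    rintro (_ | j) hj
    · exact (hj rfl).elim
    · obtain ⟨h1, h2, h3⟩ := hcone j
      constructor <;> linarith
  · obtain ⟨a, b, c, d, -, -, -, -, h⟩ := exists_terminating_chain m ρ hρ
    obtain ⟨ξ, η, -, -, -, -, hz, hz', hcone, hchain⟩ := h 0 1 one_pos (by norm_num)
    obtain ⟨hX, hY⟩ := (hρ m).image_cone (hcone m le_rfl).1 (hcone m le_rfl).2
    set X := pairFst (ρ m) (ξ m) (η m) with hXdef
    set Y := pairSnd (ρ m) (ξ m) (η m) with hYdef
    -- With term `t = m + 1` equal to zero, the recursion at `m` forces term `t + 1` to be `(X, Y) /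
    -- 300`. This lies in the cone required for a starting chain.
    obtain ⟨ξ', η', h0, h0', h1, h1', hcone', hchain'⟩ := exists_starting_chain
      (ρ := fun j => ρ (j + (m + 1))) (fun j => hρ _) (x := X / 300) (y := Y / 300)
      (by positivity) (by
        rw [abs_div, abs_of_pos (by norm_num : (0 : ℝ) < 300)]
        linarith)
    -- Both chains vanish at `m + 1`, so the glued sequence agrees with the first one up to and
    -- including that index and with the shifted second one from it on.
    have e : ∀ (f f' : ℕ → ℝ), f (m + 1) = 0 → f' 0 = 0 →
        (∀ j ≤ m + 1, (if j ≤ m then f j else f' (j - (m + 1))) = f j) ∧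
        ∀ j, (if j + (m + 1) ≤ m then f (j + (m + 1)) else f' (j + (m + 1) - (m + 1))) = f' j := by
      intro f f' hf hf'
      refine ⟨fun j hj => ?_, fun j => ?_⟩
      · rcases hj.eq_or_lt with rfl | hj
        · simp [hf, hf']
        · rw [if_pos (by omega)]
      · rw [if_neg (by omega), Nat.add_sub_cancel]
    obtain ⟨eξ, eξ'⟩ := e ξ ξ' hz h0
    obtain ⟨eη, eη'⟩ := e η η' hz' h0'
    set F : ℕ → ℝ := fun j => if j ≤ m then ξ j else ξ' (j - (m + 1)) with hF
    set G : ℕ → ℝ := fun j => if j ≤ m then η j else η' (j - (m + 1)) with hG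
    change ∀ j ≤ m + 1, F j = ξ j at eξ
    change ∀ j ≤ m + 1, G j = η j at eη
    change ∀ j, F (j + (m + 1)) = ξ' j at eξ'
    change ∀ j, G (j + (m + 1)) = η' j at eη'
    refine ⟨F, G, by rw [eξ _ le_rfl, hz], by rw [eη _ le_rfl, hz'], fun j hj => ?_, fun j => ?_⟩
    · rcases le_or_gt j m with hjm | hjm
      · rw [eξ j (by omega), eη j (by omega)]
        obtain ⟨h2, h3⟩ := hcone j hjm
        have h4 := abs_le.1 h3
        constructor <;> linarith [h4.1]
      · obtain ⟨k, rfl⟩ : ∃ k, j = (k + 1) + (m + 1) := ⟨j - (m + 1) - 1, by omega⟩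
        rw [eξ', eη']
        obtain ⟨h2, h3, h4⟩ := hcone' k
        constructor <;> linarith
    · rcases lt_trichotomy j m with hjm | rfl | hjm
      · rw [eξ j (by omega), eη j (by omega), eξ (j + 1) (by omega), eη (j + 1) (by omega),
          eξ (j + 2) (by omega), eη (j + 2) (by omega)]
        exact hchain j hjm
      · rw [eξ j (by omega), eη j (by omega), eξ (j + 1) (by omega), eη (j + 1) (by omega),
          show j + 2 = 1 + (j + 1) by omega, eξ', eη', hz, hz', h1, h1']
        constructor
        · rw [← hXdef]
          ring
        · rw [← hYdef]
          ring
      · obtain ⟨k, rfl⟩ : ∃ k, j = k + (m + 1) := ⟨j - (m + 1), by omega⟩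
        rw [show k + (m + 1) + 1 = (k + 1) + (m + 1) by omega,
          show k + (m + 1) + 2 = (k + 2) + (m + 1) by omega]
        simp only [eξ', eη']
        exact hchain' k

end Chain

/-! ### The explicit matrices and the polygon they define -/

section ExplicitMatrices

variable {n : ℕ}

/-- Equally spaced integers from `-(n - 2)` to `n - 2`, for `k = 0, …, n - 2`. -/
def slopeIndex (n : ℕ) (k : ℕ) : ℝ := 2 * k - (n - 2)

/-- All but the last row are close to `(1, 0)`, the last row is `(-1/2, 0)`. -/
noncomputable def flatMatrix (n : ℕ) : Matrix (Fin n) (Fin 2) ℝ :=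
  fun k => if k.val + 1 < n then ![1, (80 * n : ℝ)⁻¹ * slopeIndex n k] else ![-(1 / 2), 0]

/-- The right-hand side of an `n`-gon with the rows of `flatMatrix n` as normals. -/
noncomputable def flatBound (n : ℕ) : Fin n → ℝ :=
  fun k => if k.val + 1 < n then n + (80 * n : ℝ)⁻¹ * slopeIndex n k ^ 2 else 1

/-- The matrix directly below the diagonal: its rows alternate. -/
def alternatingW (n : ℕ) : Matrix (Fin n) (Fin 2) ℝ :=
  fun k => if Even k.val then ![-500, -100] else ![700, 200]

/-- The matrix in the second position below the diagonal: its rows alternate. -/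
def alternatingU (n : ℕ) : Matrix (Fin n) (Fin 2) ℝ :=
  fun k => if Even k.val then ![100, -200] else ![-200, 100]

theorem flatMatrix_of_lt {k : Fin n} (h : k.val + 1 < n) :
    flatMatrix n k 0 = 1 ∧ flatMatrix n k 1 = (80 * n : ℝ)⁻¹ * slopeIndex n k := by
  simp [flatMatrix, h]

theorem flatMatrix_last {k : Fin n} (h : ¬ k.val + 1 < n) :
    flatMatrix n k 0 = -(1 / 2) ∧ flatMatrix n k 1 = 0 := by
  simp [flatMatrix, h]

theorem abs_slopeIndex_le {k : ℕ} (h : k + 1 < n) : |slopeIndex n k| ≤ n - 2 := by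
  have h1 : (k : ℝ) + 2 ≤ n := by exact_mod_cast h
  have h2 : (0 : ℝ) ≤ k := k.cast_nonneg
  unfold slopeIndex
  exact abs_le.2 ⟨by linarith, by linarith⟩

theorem abs_flatMatrix_snd_le (hn : 4 ≤ n) (k : Fin n) : |flatMatrix n k 1| ≤ 1 / 80 := by
  by_cases h : k.val + 1 < n
  · have hn' : (4 : ℝ) ≤ n := by exact_mod_cast hn
    rw [(flatMatrix_of_lt h).2, abs_mul, abs_of_pos (by positivity), inv_mul_le_iff₀ (by positivity)]
    linarith [abs_slopeIndex_le h]
  · rw [(flatMatrix_last h).2]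
    norm_num

theorem consecutiveIndependent_flatMatrix (hn : 4 ≤ n) :
    ConsecutiveIndependent (flatMatrix n) := by
  intro k
  have hn' : (4 : ℝ) ≤ n := by exact_mod_cast hn
  have hc : (0 : ℝ) < (80 * n : ℝ)⁻¹ := by positivity
  set c := (80 * n : ℝ)⁻¹
  have hs := cyclicSucc_val k
  by_cases h1 : k.val + 1 < n
  · rw [if_pos h1] at hs
    by_cases h2 : k.val + 2 < n
    · have h3 : (cyclicSucc k).val + 1 < n := by omega
      rw [(flatMatrix_of_lt h1).1, (flatMatrix_of_lt h1).2, (flatMatrix_of_lt h3).1,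
        (flatMatrix_of_lt h3).2, hs]
      unfold slopeIndex
      push_cast
      refine ne_of_gt ?_
      linarith
    · have h3 : ¬ (cyclicSucc k).val + 1 < n := by omega
      have h4 : (k.val : ℝ) + 2 = n := by exact_mod_cast (by omega : k.val + 2 = n)
      rw [(flatMatrix_of_lt h1).1, (flatMatrix_of_lt h1).2, (flatMatrix_last h3).1,
        (flatMatrix_last h3).2]
      have : 0 < c * slopeIndex n k := mul_pos hc (by unfold slopeIndex; linarith)
      refine ne_of_gt ?_
      linarith
  · rw [if_neg h1] at hs
    have h3 : (cyclicSucc k).val + 1 < n := by omega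
    rw [(flatMatrix_last h1).1, (flatMatrix_last h1).2, (flatMatrix_of_lt h3).1,
      (flatMatrix_of_lt h3).2, hs]
    have : 0 < c * (-slopeIndex n 0) :=
      mul_pos hc (by unfold slopeIndex; push_cast; linarith)
    refine ne_of_gt ?_
    change 0 < -(1 / 2) * (c * slopeIndex n 0) - 0 * 1
    linarith

theorem flatBound_pos (hn : 4 ≤ n) (k : Fin n) : 0 < flatBound n k := by
  have hn' : (4 : ℝ) ≤ n := by exact_mod_cast hn
  unfold flatBound
  split_ifs <;> positivity

theorem flat_row_of_lt {k : Fin n} (h : k.val + 1 < n) (x y : ℝ) :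
    (flatMatrix n).mulVec ![x, y] k = x + (80 * n : ℝ)⁻¹ * slopeIndex n k * y := by
  rw [mulVec_fin_two, (flatMatrix_of_lt h).1, (flatMatrix_of_lt h).2]
  simp

theorem flat_row_last {k : Fin n} (h : ¬ k.val + 1 < n) (x y : ℝ) :
    (flatMatrix n).mulVec ![x, y] k = -(x / 2) := by
  rw [mulVec_fin_two, (flatMatrix_last h).1, (flatMatrix_last h).2]
  simp
  ring

theorem hasCyclicVertices_flat (hn : 4 ≤ n) :
    HasCyclicVertices (flatMatrix n) (flatBound n) := by
  intro k
  have hn' : (4 : ℝ) ≤ n := by exact_mod_cast hn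
  have hc : (0 : ℝ) < (80 * n : ℝ)⁻¹ := by positivity
  have hcn : (80 * n : ℝ)⁻¹ * n = 1 / 80 := by field_simp
  have hb1 : ∀ {l : Fin n}, l.val + 1 < n →
      flatBound n l = n + (80 * n : ℝ)⁻¹ * slopeIndex n l ^ 2 := fun h => by simp [flatBound, h]
  have hb2 : ∀ {l : Fin n}, ¬ l.val + 1 < n → flatBound n l = 1 := fun h => by simp [flatBound, h]
  have hrow1 := @flat_row_of_lt n
  set c := (80 * n : ℝ)⁻¹
  have hs := cyclicSucc_val k
  set S : ℝ := n - 2 with hS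
  have hS0 : 0 < S := by linarith
  -- The two vertices on the line `x = -2` have second coordinate `±(S + (n + 2) / (c * S))`. The
  -- difference of the two sides factors as `(S - u) * ((n + 2) / S - c * u)`.
  have hfar : ∀ u : ℝ, -S ≤ u → u < S → c * u * (S + (n + 2) / (c * S)) < n + 2 + c * u ^ 2 := by
    intro u h1 h2
    have e : n + 2 + c * u ^ 2 - c * u * (S + (n + 2) / (c * S)) =
        (S - u) * ((n + 2) / S - c * u) := by
      field_simp
      ring
    have h3 : 1 ≤ (n + 2) / S := by
      rw [le_div_iff₀ hS0]
      linarith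
    have h4 : c * u ≤ c * n := mul_le_mul_of_nonneg_left (by linarith) hc.le
    have h5 : 0 < (S - u) * ((n + 2) / S - c * u) := mul_pos (by linarith) (by linarith)
    linarith
  have hYS : c * S * (S + (n + 2) / (c * S)) = c * S ^ 2 + (n + 2) := by
    field_simp
  by_cases h1 : k.val + 1 < n
  · rw [if_pos h1] at hs
    by_cases h2 : k.val + 2 < n
    · have h3 : (cyclicSucc k).val + 1 < n := by omega
      set σ := slopeIndex n k with hσ
      have hσ' : slopeIndex n (cyclicSucc k).val = σ + 2 := by
        rw [hs, hσ]
        unfold slopeIndex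
        push_cast
        ring
      -- The lines `x + c s y = n + c s ^ 2` are tangent to a parabola. At the intersection of those
      -- for `σ` and `σ + 2`, the slack of the line for `s` is `c (s - σ) (s - σ - 2)`, positive for
      -- every other index `s`.
      refine ⟨![n - c * (σ * (σ + 2)), 2 * σ + 2], ?_, ?_, fun l hl1 hl2 => ?_⟩
      · rw [hrow1 h1, hb1 h1]
        ring
      · rw [hrow1 h3, hb1 h3, hσ']
        ring
      · by_cases h4 : l.val + 1 < n
        · rw [hrow1 h4, hb1 h4]
          have h5 : 0 < (slopeIndex n l - σ) * (slopeIndex n l - σ - 2) := by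
            have e1 : slopeIndex n l - σ = 2 * ((l.val : ℝ) - k.val) := by
              rw [hσ]
              unfold slopeIndex
              ring
            rw [e1]
            rcases lt_or_gt_of_ne (fun h => hl1 (Fin.ext h)) with h | h
            · have : (l.val : ℝ) + 1 ≤ k.val := by exact_mod_cast h
              exact mul_pos_of_neg_of_neg (by linarith) (by linarith)
            · have h6 : l.val ≠ k.val + 1 := fun h => hl2 (Fin.ext (by omega))
              have : (k.val : ℝ) + 2 ≤ l.val := by exact_mod_cast (by omega : k.val + 2 ≤ l.val)
              exact mul_pos (by linarith) (by linarith)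
          have := mul_pos hc h5
          linarith
        · rw [flat_row_last h4, hb2 h4]
          obtain ⟨h5, h6⟩ := abs_le.1 (abs_slopeIndex_le h1)
          have h7 : σ * (σ + 2) ≤ n * n := by nlinarith
          have h8 := mul_le_mul_of_nonneg_left h7 hc.le
          rw [← mul_assoc c (n : ℝ), hcn] at h8
          linarith
    · have h3 : ¬ (cyclicSucc k).val + 1 < n := by omega
      have hσ : slopeIndex n k.val = S := by
        have h4 : (k.val : ℝ) + 2 = n := by exact_mod_cast (by omega : k.val + 2 = n)
        unfold slopeIndex
        linarith
      refine ⟨![-2, S + (n + 2) / (c * S)], ?_, ?_, fun l hl1 hl2 => ?_⟩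
      · rw [hrow1 h1, hb1 h1, hσ, hYS]
        ring
      · rw [flat_row_last h3, hb2 h3]
        norm_num
      · have h4 : l.val + 1 < n := by
          by_contra h
          exact hl2 (Fin.ext (by omega))
        rw [hrow1 h4, hb1 h4]
        have h5 : l.val < k.val := by
          have : l.val ≠ k.val := fun h => hl1 (Fin.ext h)
          omega
        have h6 : slopeIndex n l < S := by
          rw [← hσ]
          unfold slopeIndex
          have : (l.val : ℝ) < k.val := by exact_mod_cast h5
          linarith
        linarith [hfar _ (abs_le.1 (abs_slopeIndex_le h4)).1 h6]
  · rw [if_neg h1] at hs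
    have h3 : (cyclicSucc k).val + 1 < n := by omega
    have hσ : slopeIndex n (cyclicSucc k).val = -S := by
      rw [hs]
      unfold slopeIndex
      push_cast
      ring
    refine ⟨![-2, -(S + (n + 2) / (c * S))], ?_, ?_, fun l hl1 hl2 => ?_⟩
    · rw [flat_row_last h1, hb2 h1]
      norm_num
    · rw [hrow1 h3, hb1 h3, hσ]
      linear_combination hYS
    · have h4 : l.val + 1 < n := by
        by_contra h
        exact hl1 (Fin.ext (by omega))
      rw [hrow1 h4, hb1 h4]
      have h6 : -slopeIndex n l < S := by
        have h5 : l.val ≠ 0 := fun h => hl2 (Fin.ext (by omega))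
        have : (1 : ℝ) ≤ l.val := by exact_mod_cast (by omega : 1 ≤ l.val)
        unfold slopeIndex
        linarith
      have := hfar (-slopeIndex n l) (by linarith [(abs_le.1 (abs_slopeIndex_le h4)).2]) h6
      linarith

theorem posSpan_flatMatrix (hn : 4 ≤ n) (y : Fin 2 → ℝ) :
    ∃ c : Fin n → ℝ, (∀ k, 0 ≤ c k) ∧ y = ∑ k, c k • flatMatrix n k := by
  have hn' : (4 : ℝ) ≤ n := by exact_mod_cast hn
  let i₀ : Fin n := ⟨0, by omega⟩
  let i₁ : Fin n := ⟨n - 2, by omega⟩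
  let i₂ : Fin n := ⟨n - 1, by omega⟩
  have h0 : i₀.val + 1 < n := by simp only [i₀]; omega
  have h1 : i₁.val + 1 < n := by simp only [i₁]; omega
  have h2 : ¬ i₂.val + 1 < n := by simp only [i₂]; omega
  obtain ⟨a0, b0⟩ := flatMatrix_of_lt h0
  obtain ⟨a1, b1⟩ := flatMatrix_of_lt h1
  obtain ⟨a2, b2⟩ := flatMatrix_last h2
  set s := (80 * n : ℝ)⁻¹ * slopeIndex n i₁ with hs
  have e1 : slopeIndex n i₁ = n - 2 := by
    simp only [slopeIndex, i₁]
    rw [Nat.cast_sub (by omega)]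
    push_cast
    ring
  have e0 : slopeIndex n i₀ = -(n - 2) := by
    simp [slopeIndex, i₀]
  have hs0 : 0 < s := by
    rw [hs, e1]
    exact mul_pos (by positivity) (by linarith)
  have b0' : flatMatrix n i₀ 1 = -s := by
    rw [b0, e0, hs, e1]
    ring
  -- Rows `i₀` and `i₁` have slopes `-s` and `s`; weights `K` and `K + y 1 / s` produce the second
  -- coordinate. `K` is large enough that the horizontal row `i₂` corrects the first coordinate with
  -- a nonnegative weight.
  set K := |y 1 / s| + |y 0| with hK
  have hK0 : 0 ≤ K := by positivity
  have hp1 := neg_abs_le (y 1 / s)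
  have hp2 := le_abs_self (y 0)
  have hp3 := abs_nonneg (y 0)
  have hp4 := abs_nonneg (y 1 / s)
  refine ⟨fun k => (if k = i₀ then K else 0) + (if k = i₁ then K + y 1 / s else 0) +
    (if k = i₂ then 2 * (2 * K + y 1 / s - y 0) else 0), fun k => ?_, ?_⟩
  · refine add_nonneg (add_nonneg ?_ ?_) ?_ <;> split_ifs <;> linarith
  · have hsum : ∀ j : Fin 2, (∑ k, ((if k = i₀ then K else 0) +
        (if k = i₁ then K + y 1 / s else 0) +
        (if k = i₂ then 2 * (2 * K + y 1 / s - y 0) else 0)) • flatMatrix n k) j =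
        K * flatMatrix n i₀ j + (K + y 1 / s) * flatMatrix n i₁ j +
          2 * (2 * K + y 1 / s - y 0) * flatMatrix n i₂ j := by
      intro j
      rw [Finset.sum_apply]
      simp only [Pi.smul_apply, smul_eq_mul, add_mul, ite_mul, zero_mul, Finset.sum_add_distrib,
        Finset.sum_ite_eq', Finset.mem_univ, if_true]
    ext j
    rw [hsum]
    fin_cases j
    · simp only [Fin.zero_eta, a0, a1, a2]
      ring
    · simp only [Fin.mk_one, b0', b1, b2]
      field_simp
      ring

theorem isPolygonMatrix_flatMatrix (hn : 4 ≤ n) : IsPolygonMatrix (flatMatrix n) where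
  cyclic := by
    have hn' : (4 : ℝ) ≤ n := by exact_mod_cast hn
    have hc : (0 : ℝ) < (80 * n : ℝ)⁻¹ := by positivity
    set c := (80 * n : ℝ)⁻¹ with hcdef
    have hpi := Real.pi_pos
    refine ⟨fun k => if k.val + 1 < n then √(1 + (c * slopeIndex n k) ^ 2) else 1 / 2,
      fun k => if k.val + 1 < n then Real.arctan (c * slopeIndex n k) else Real.pi, fun k => ?_,
      fun k l hkl => ?_, fun k l => ?_, fun k => ?_⟩
    · simp only
      split_ifs <;> positivity
    · have hkl' : k.val < l.val := hkl
      have h1 : k.val + 1 < n := by omega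
      simp only [if_pos h1]
      split_ifs with h2
      · refine Real.arctan_strictMono (mul_lt_mul_of_pos_left ?_ hc)
        unfold slopeIndex
        have : (k.val : ℝ) < l.val := by exact_mod_cast hkl'
        linarith
      · linarith [Real.arctan_lt_pi_div_two (c * slopeIndex n k)]
    · simp only
      have h1 := Real.arctan_lt_pi_div_two (c * slopeIndex n l)
      have h2 := Real.neg_pi_div_two_lt_arctan (c * slopeIndex n k)
      split_ifs <;> linarith
    · simp only
      split_ifs with h
      · have h0 : 0 < √(1 + (c * slopeIndex n k) ^ 2) := by positivity
        rw [Real.cos_arctan, Real.sin_arctan, (flatMatrix_of_lt h).1, (flatMatrix_of_lt h).2]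
        constructor
        · field_simp
        · rw [mul_div_cancel₀ _ h0.ne']
      · rw [(flatMatrix_last h).1, (flatMatrix_last h).2]
        simp
  posSpan := posSpan_flatMatrix hn

/-- Two consecutive rows consist of one row of even and one row of odd index. -/
theorem exists_even_odd_pair (hn : 4 ≤ n) (hne : Even n) (k : Fin n) :
    ∃ e o : Fin n, ({k, cyclicSucc k} : Set (Fin n)) = {e, o} ∧ Even e.val ∧ ¬ Even o.val ∧
      flatMatrix n e 0 = 1 ∧ IsFlatPair (flatMatrix n o 0, flatMatrix n e 1, flatMatrix n o 1) := by
  obtain ⟨e, o, h, he, ho⟩ : ∃ e o : Fin n, ({k, cyclicSucc k} : Set (Fin n)) = {e, o} ∧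
      Even e.val ∧ ¬ Even o.val := by
    have hs := cyclicSucc_val k
    have hk := k.isLt
    by_cases hkn : k.val + 1 < n
    · rw [if_pos hkn] at hs
      by_cases h : Even k.val
      · exact ⟨k, cyclicSucc k, rfl, h, by rw [hs]; grind⟩
      · exact ⟨cyclicSucc k, k, pair_comm _ _, by rw [hs]; grind, h⟩
    · rw [if_neg hkn] at hs
      exact ⟨cyclicSucc k, k, pair_comm _ _, by rw [hs]; grind, by grind⟩
  -- The last index `n - 1` is odd, so the exceptional row `(-1/2, 0)` can occur only as the odd row
  -- of a pair.
  have he1 : e.val + 1 < n := by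
    have := e.isLt
    grind
  refine ⟨e, o, h, he, ho, (flatMatrix_of_lt he1).1, ?_, ?_, abs_flatMatrix_snd_le hn _,
    abs_flatMatrix_snd_le hn _⟩ <;> simp only <;> by_cases h' : o.val + 1 < n
  · rw [(flatMatrix_of_lt h').1]; norm_num
  · rw [(flatMatrix_last h').1]
  · rw [(flatMatrix_of_lt h').1]
  · rw [(flatMatrix_last h').1]; norm_num

end ExplicitMatrices

/-! ### Faces that survive the projection -/

section Survival

variable {r n : ℕ}

/-- Regroups a sum over row blocks by column blocks: in the application `f j`, `g (j + 1)` and `h (j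
+ 2)` all involve the same block of variables, and the boundary terms involve blocks that are zero.
-/
theorem sum_shifted_eq_zero {f g h : ℕ → ℝ} {q : ℕ} (hf : f q = 0) (hf' : f (q + 1) = 0)
    (hg : g 0 = 0) (hg' : g (q + 1) = 0) (hh : h 0 = 0) (hh' : h 1 = 0)
    (hsum : ∀ j < q, f j + g (j + 1) + h (j + 2) = 0) :
    ∑ i ∈ Finset.range (q + 2), (f i + g i + h i) = 0 := by
  have h1 : ∑ i ∈ Finset.range (q + 2), f i = ∑ i ∈ Finset.range q, f i := by
    rw [Finset.sum_range_succ, Finset.sum_range_succ, hf, hf', add_zero, add_zero]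
  have h2 : ∑ i ∈ Finset.range (q + 2), g i = ∑ i ∈ Finset.range q, g (i + 1) := by
    rw [Finset.sum_range_succ, hg', add_zero, Finset.sum_range_succ', hg, add_zero]
  have h3 : ∑ i ∈ Finset.range (q + 2), h i = ∑ i ∈ Finset.range q, h (i + 2) := by
    rw [Finset.sum_range_succ', hh, add_zero, Finset.sum_range_succ', zero_add, hh', add_zero]
  rw [Finset.sum_add_distrib, Finset.sum_add_distrib, h1, h2, h3, ← Finset.sum_add_distrib,
    ← Finset.sum_add_distrib]
  exact Finset.sum_eq_zero fun j hj => hsum j (Finset.mem_range.1 hj)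

theorem shiftedBlock_eq_zero_of_lastCoords {h4 : 4 ≤ 2 * r} {x : Fin (2 * r) → ℝ}
    (hx : lastCoords h4 x = 0) : shiftedBlock x r = 0 ∧ shiftedBlock x (r + 1) = 0 := by
  have hc : ∀ c : Fin (2 * r), 2 * r - 4 ≤ c.val → x c = 0 := by
    intro c hc
    have h := congrFun hx ⟨c.val - (2 * r - 4), by omega⟩
    refine Eq.trans (congrArg x (Fin.ext ?_)) h
    simp only
    omega
  constructor
  · ext s
    obtain ⟨q, rfl⟩ : ∃ q, r = q + 2 := ⟨r - 2, by omega⟩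
    rw [shiftedBlock_add_two x ⟨q, by omega⟩]
    exact hc _ (by simp only; omega)
  · ext s
    obtain ⟨q, rfl⟩ : ∃ q, r = q + 1 := ⟨r - 1, by omega⟩
    rw [show q + 1 + 1 = q + 2 from rfl, shiftedBlock_add_two x ⟨q, by omega⟩]
    exact hc _ (by simp only; omega)

/-- No nonzero vector in the kernel of the projection is annihilated by the inequalities of a
polygon face. -/
theorem eq_zero_of_rows {V W U : Matrix (Fin n) (Fin 2) ℝ} (h4 : 4 ≤ 2 * r)
    (hV : ConsecutiveIndependent V) (hU : ConsecutiveIndependent U) (t : Fin r)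
    (κ : Fin r → Fin n) {x : Fin (2 * r) → ℝ}
    (h : ∀ i, i ≠ t → (deformedMatrix r V W U).mulVec x (i, κ i) = 0 ∧
      (deformedMatrix r V W U).mulVec x (i, cyclicSucc (κ i)) = 0)
    (hx : lastCoords h4 x = 0) : x = 0 := by
  obtain ⟨hr, hr1⟩ := shiftedBlock_eq_zero_of_lastCoords hx
  simp only [deformedMatrix_mulVec] at h
  -- Forward elimination: row block `i < t` with blocks `i` and `i + 1` zero leaves `V` acting on
  -- block `i + 2`.
  have hlow : ∀ m, m ≤ t.val + 1 → shiftedBlock x m = 0 := by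
    intro m
    induction m using Nat.strong_induction_on with
    | _ m ih =>
      intro hm
      rcases lt_or_ge m 2 with h2 | h2
      · exact shiftedBlock_of_lt_two _ h2
      · obtain ⟨i, rfl⟩ : ∃ i, m = i + 2 := ⟨m - 2, by omega⟩
        have h3 := h ⟨i, by omega⟩ (fun he => by rw [← he] at hm; simp only at hm; omega)
        simp only [ih i (by omega) (by omega), ih (i + 1) (by omega) (by omega),
          Matrix.mulVec_zero, Pi.zero_apply, add_zero] at h3
        exact eq_zero_of_consecutive hV h3.1 h3.2
  -- Backward elimination from the two last blocks, which vanish on the kernel: row block `m > t`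
  -- with blocks `m + 1` and `m + 2` zero leaves `U` acting on block `m`.
  have hhigh : ∀ p m, m + p = r + 1 → t.val < m → shiftedBlock x m = 0 := by
    intro p
    induction p using Nat.strong_induction_on with
    | _ p ih =>
      intro m hmp hm
      rcases lt_or_ge p 2 with h2 | h2
      · interval_cases p
        · rw [show m = r + 1 by omega, hr1]
        · rw [show m = r by omega, hr]
      · have h3 := h ⟨m, by omega⟩ (fun he => by rw [← he] at hm; simp only at hm; omega)
        simp only [ih (p - 1) (by omega) (m + 1) (by omega) (by omega),
          ih (p - 2) (by omega) (m + 2) (by omega) (by omega),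
          Matrix.mulVec_zero, Pi.zero_apply, zero_add] at h3
        exact eq_zero_of_consecutive hU h3.1 h3.2
  refine eq_zero_of_shiftedBlock fun m hm => ?_
  rcases le_or_gt m (t.val + 1) with h5 | h5
  · exact hlow m h5
  · exact hhigh (r + 1 - m) m (by omega) (by omega)

theorem consecutiveIndependent_alternatingU (hne : Even n) :
    ConsecutiveIndependent (alternatingU n) := by
  intro k
  have hs := cyclicSucc_val k
  have hk := k.isLt
  have h : Even (cyclicSucc k).val ↔ ¬ Even k.val := by
    rw [hs]
    split_ifs <;> grind
  unfold alternatingU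
  by_cases hk' : Even k.val
  · have h' : ¬ Even (cyclicSucc k).val := by tauto
    simp only [hk', h', if_true, if_false]
    norm_num
  · have h' : Even (cyclicSucc k).val := by tauto
    simp only [hk', h', if_true, if_false]
    norm_num

/-- A face of the deformed product in which two consecutive inequalities are tight in all but one
block survives the projection to the last four coordinates. -/
theorem strictlyPreserved_of_pairs (hn : 4 ≤ n) (hne : Even n) (h4 : 4 ≤ 2 * r)
    {d : Fin r × Fin n → ℝ} {S : Set (Fin r × Fin n)} (t : Fin r)
    (hS : ∀ i, i ≠ t → ∃ k, {k | (i, k) ∈ S} = {k, cyclicSucc k})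
    (hface : (activeFace (rowFunctional (deformedMatrix r (flatMatrix n) (alternatingW n)
      (alternatingU n))) d S).Nonempty) :
    StrictlyPreserved (lastCoords h4)
      (halfspaces (rowFunctional (deformedMatrix r (flatMatrix n) (alternatingW n)
        (alternatingU n))) d)
      (activeFace (rowFunctional (deformedMatrix r (flatMatrix n) (alternatingW n)
        (alternatingU n))) d S) := by
  classical
  have hS' : ∀ i, ∃ k, i ≠ t → {k | (i, k) ∈ S} = {k, cyclicSucc k} := fun i => by
    by_cases hi : i = t
    · exact ⟨⟨0, by omega⟩, fun h => (h hi).elim⟩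
    · obtain ⟨k, hk⟩ := hS i hi
      exact ⟨k, fun _ => hk⟩
  choose κ hκ using hS'
  have hpair := fun i => exists_even_odd_pair hn hne (κ i)
  choose e o heo he ho he0 hflat using hpair
  -- The recursion is solved on all of `ℕ`; the default `(1, 0, 0)` is just some flat pair.
  let ρ : ℕ → ℝ × ℝ × ℝ := fun j => if h : j < r then
    (flatMatrix n (o ⟨j, h⟩) 0, flatMatrix n (e ⟨j, h⟩) 1, flatMatrix n (o ⟨j, h⟩) 1) else (1, 0, 0)
  have hρ : ∀ j, IsFlatPair (ρ j) := fun j => by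
    by_cases h : j < r
    · simp only [ρ, h, dif_pos]
      exact hflat _
    · simp only [ρ, h, dif_neg, not_false_eq_true]
      constructor <;> norm_num
  have hρi : ∀ i : Fin r, ρ i.val =
      (flatMatrix n (o i) 0, flatMatrix n (e i) 1, flatMatrix n (o i) 1) := fun i => by
    simp [ρ]
  obtain ⟨α, β, hαt, hβt, hpos, hdep⟩ := exists_positive_dependency hρ t.val
  have hne' : ∀ i, e i ≠ o i := fun i h => ho i (h ▸ he i)
  have hmem : ∀ i, i ≠ t → ∀ k, (i, k) ∈ S ↔ k = e i ∨ k = o i := by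
    intro i hi k
    have h := Set.ext_iff.1 ((hκ i hi).trans (heo i)) k
    simpa using h
  -- Tight inequalities in block `t` are left out of `S₀`, matching the zero of the relation at `t`;
  -- at a vertex such inequalities do occur.
  refine strictlyPreserved_activeFace (S₀ := {p | p.1 ≠ t ∧ p ∈ S}) (fun p hp => hp.2) hface
    (fun p => (if p.2 = e p.1 then α p.1.val else 0) + if p.2 = o p.1 then β p.1.val else 0)
    ?_ ?_ ?_ ?_
  · rintro ⟨i, k⟩ ⟨hi, hik⟩
    have hi' : i.val ≠ t.val := fun h => hi (Fin.ext h)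
    rcases (hmem i hi k).1 hik with rfl | rfl
    · simpa [hne' i] using (hpos _ hi').1
    · simpa [(hne' i).symm] using (hpos _ hi').2
  · rintro ⟨i, k⟩ hik
    by_cases hi : i = t
    · simp [hi, hαt, hβt]
    · have h1 : (i, k) ∉ S := fun h => hik ⟨hi, h⟩
      rw [hmem i hi] at h1
      push Not at h1
      simp [h1.1, h1.2]
  · intro x hx
    obtain ⟨hr0, hr1⟩ := shiftedBlock_eq_zero_of_lastCoords hx
    set X := shiftedBlock x with hX
    have hX0 : X 0 = 0 := shiftedBlock_of_lt_two _ (by omega)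
    have hX1 : X 1 = 0 := shiftedBlock_of_lt_two _ (by omega)
    rw [Fintype.sum_prod_type]
    simp only [add_mul, ite_mul, zero_mul, Finset.sum_add_distrib, Finset.sum_ite_eq',
      Finset.mem_univ, if_true]
    rw [← Finset.sum_add_distrib]
    have hterm : ∀ i : Fin r,
        α i.val * rowFunctional (deformedMatrix r (flatMatrix n) (alternatingW n)
            (alternatingU n)) (i, e i) x +
          β i.val * rowFunctional (deformedMatrix r (flatMatrix n) (alternatingW n)
            (alternatingU n)) (i, o i) x =
        ((α i.val + (ρ i.val).1 * β i.val) * X (i.val + 2) 0 +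
          ((ρ i.val).2.1 * α i.val + (ρ i.val).2.2 * β i.val) * X (i.val + 2) 1) +
        ((-500 * α i.val + 700 * β i.val) * X (i.val + 1) 0 +
          (-100 * α i.val + 200 * β i.val) * X (i.val + 1) 1) +
        ((100 * α i.val - 200 * β i.val) * X i.val 0 +
          (-200 * α i.val + 100 * β i.val) * X i.val 1) := by
      intro i
      simp only [rowFunctional_apply, deformedMatrix_mulVec, mulVec_fin_two, ← hX, hρi, he0]
      simp only [alternatingW, alternatingU, he i, ho i, if_true, if_false, Matrix.cons_val_zero,
        Matrix.cons_val_one]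
      ring
    rw [Finset.sum_congr rfl fun i _ => hterm i]
    rw [Fin.sum_univ_eq_sum_range (fun i => ((α i + (ρ i).1 * β i) * X (i + 2) 0 +
          ((ρ i).2.1 * α i + (ρ i).2.2 * β i) * X (i + 2) 1) +
        ((-500 * α i + 700 * β i) * X (i + 1) 0 + (-100 * α i + 200 * β i) * X (i + 1) 1) +
        ((100 * α i - 200 * β i) * X i 0 + (-200 * α i + 100 * β i) * X i 1))]
    obtain ⟨q, hq⟩ : ∃ q, r = q + 2 := ⟨r - 2, by omega⟩
    have hXq : X (q + 2) = 0 := by rw [← hq]; exact hr0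
    have hXq1 : X (q + 1 + 2) = 0 := by rw [show q + 1 + 2 = r + 1 by omega]; exact hr1
    rw [hq]
    refine sum_shifted_eq_zero (f := fun i => (α i + (ρ i).1 * β i) * X (i + 2) 0 +
          ((ρ i).2.1 * α i + (ρ i).2.2 * β i) * X (i + 2) 1)
        (g := fun i => (-500 * α i + 700 * β i) * X (i + 1) 0 +
          (-100 * α i + 200 * β i) * X (i + 1) 1)
        (h := fun i => (100 * α i - 200 * β i) * X i 0 + (-200 * α i + 100 * β i) * X i 1)
        ?_ ?_ ?_ ?_ ?_ ?_ ?_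
    · simp [hXq]
    · simp [hXq1]
    · simp [hX1]
    · simp [hXq]
    · simp [hX0]
    · simp [hX1]
    · intro j _
      obtain ⟨h1, h2⟩ := hdep j
      linear_combination X (j + 2) 0 * h1 + X (j + 2) 1 * h2
  · intro x hrows hx
    refine eq_zero_of_rows (W := alternatingW n) h4 (consecutiveIndependent_flatMatrix hn)
      (consecutiveIndependent_alternatingU hne) t κ (fun i hi => ?_) hx
    have h := Set.ext_iff.1 (hκ i hi)
    exact ⟨hrows (i, κ i) ⟨hi, (h (κ i)).2 (by simp)⟩,
      hrows (i, cyclicSucc (κ i)) ⟨hi, (h (cyclicSucc (κ i))).2 (by simp)⟩⟩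

/-- If at least `2r - 1` inequalities are tight, then there are two consecutive ones in all blocks
but one. -/
theorem exists_pairs_of_card {S : Set (Fin r × Fin n)} (hr : 0 < r) (hS : S ∈ productActiveSets r n)
    (hcard : 2 * r ≤ S.ncard + 1) :
    ∃ t : Fin r, ∀ i, i ≠ t → ∃ k, {k | (i, k) ∈ S} = {k, cyclicSucc k} := by
  classical
  have hsum : S.ncard = ∑ i, {k | (i, k) ∈ S}.ncard := by
    simp only [ncard_eq_toFinset_card', toFinset_ofPred]
    rw [show S.toFinset = Finset.univ.filter (· ∈ S) by ext; simp, Finset.card_filter,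
      Fintype.sum_prod_type]
    simp only [Finset.card_filter]
  have h2 : ∀ i, {k | (i, k) ∈ S}.ncard ≤ 2 := fun i => by
    rcases hS i with h | ⟨k, h⟩ | ⟨k, h⟩ <;> rw [h]
    · simp
    · simp
    · exact (ncard_insert_le _ _).trans (by simp)
  have h1 : ∀ i, (¬ ∃ k, {k | (i, k) ∈ S} = {k, cyclicSucc k}) →
      {k | (i, k) ∈ S}.ncard ≤ 1 := fun i hi => by
    rcases hS i with h | ⟨k, h⟩ | ⟨k, h⟩
    · rw [h]; simp
    · rw [h]; simp
    · exact (hi ⟨k, h⟩).elim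
  by_contra! hcon
  -- Two distinct blocks without a tight pair would leave at most `2 * r - 2` tight inequalities.
  obtain ⟨i₁, -, hi₁⟩ := hcon ⟨0, hr⟩
  obtain ⟨i₂, hne, hi₂⟩ := hcon i₁
  have hle : ∑ i, ({k | (i, k) ∈ S}.ncard + (if i = i₁ then 1 else 0) +
      (if i = i₂ then 1 else 0)) ≤ ∑ _i : Fin r, 2 := by
    refine Finset.sum_le_sum fun i _ => ?_
    by_cases e1 : i = i₁
    · have := h1 i (by rw [e1]; push Not; exact hi₁)
      have e2 : i ≠ i₂ := fun e2 => hne (e2.symm.trans e1)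
      rw [if_pos e1, if_neg e2]
      omega
    · by_cases e2 : i = i₂
      · have := h1 i (by rw [e2]; push Not; exact hi₂)
        simp only [e1, if_false]
        rw [if_pos e2]
        omega
      · have := h2 i
        simp only [e1, e2, if_false]
        omega
  rw [Finset.sum_add_distrib, Finset.sum_add_distrib, ← hsum] at hle
  simp at hle
  omega

end Survival

/-! ### The main theorem -/

theorem mainTheorem2 (r n : ℕ) (hr : 2 ≤ r) (hn : 4 ≤ n) (hne : Even n) :
    ∃ (V W U : Matrix (Fin n) (Fin 2) ℝ) (b : Fin n → ℝ) (d : Fin r × Fin n → ℝ)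
      (φ : Face (productPower r (polyhedron V b)) ≃o
        Face (polyhedron (deformedMatrix r V W U) d)),
      IsPolygonMatrix V ∧ (∀ k, 0 < b k) ∧ IsNGon n (polyhedron V b) ∧
      IsPolytope (polyhedron (deformedMatrix r V W U) d) ∧
      MatchesFacets V b (deformedMatrix r V W U) d φ ∧
      (∀ G, IsFaceOfDim (polyhedron (deformedMatrix r V W U) d) 0 G →
        StrictlyPreserved (lastCoords (m := 2 * r) (k := 4) (by omega))
          (polyhedron (deformedMatrix r V W U) d) G) ∧
      (∀ G, IsFaceOfDim (polyhedron (deformedMatrix r V W U) d) 1 G →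
        StrictlyPreserved (lastCoords (m := 2 * r) (k := 4) (by omega))
          (polyhedron (deformedMatrix r V W U) d) G) ∧
      (∀ F : Face (productPower r (polyhedron V b)), IsPolygonFace (polyhedron V b) F.1 →
        StrictlyPreserved (lastCoords (m := 2 * r) (k := 4) (by omega))
          (polyhedron (deformedMatrix r V W U) d) (φ F).1) := by
  have hV := consecutiveIndependent_flatMatrix hn
  have hb := hasCyclicVertices_flat hn
  have hspan := posSpan_flatMatrix hn
  obtain ⟨d, himg, hbdd⟩ := exists_deformedProduct (W := alternatingW n) (U := alternatingU n)
    r hn hV hb hspan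
  set a' := rowFunctional (deformedMatrix r (flatMatrix n) (alternatingW n) (alternatingU n))
  set a := productRow r (flatMatrix n)
  have himgP : activeSet a (fun p => flatBound n p.2) '' halfspaces a (fun p => flatBound n p.2) =
      productActiveSets r n := activeSet_image_productPower hn hV hb
  have huniv : univ ∉ productActiveSets r n := by
    intro h
    have h1 := h ⟨0, by omega⟩
    have h2 : ∀ k : Fin n, k ∈ {k : Fin n | ((⟨0, by omega⟩ : Fin r), k) ∈
        (univ : Set (Fin r × Fin n))} := fun _ => trivial
    rcases h1 with h | ⟨k, h⟩ | ⟨k, h⟩ <;> rw [h] at h2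
    · exact h2 ⟨0, by omega⟩
    · have e0 := h2 ⟨0, by omega⟩
      have e1 := h2 ⟨1, by omega⟩
      simp only [mem_singleton_iff, Fin.ext_iff] at e0 e1
      omega
    · have e0 := h2 ⟨0, by omega⟩
      have e1 := h2 ⟨1, by omega⟩
      have e2 := h2 ⟨2, by omega⟩
      simp only [mem_insert_iff, mem_singleton_iff, Fin.ext_iff] at e0 e1 e2
      omega
  have hfaces := himgP.trans himg.symm
  obtain ⟨φ, hφ⟩ := exists_faceOrderIso (productPower_eq_halfspaces (V := flatMatrix n)
    (b := flatBound n) (r := r)) (polyhedron_eq_halfspaces (deformedMatrix r (flatMatrix n)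
      (alternatingW n) (alternatingU n)) d) hfaces
    (fun x hx h => huniv (by rw [← h, ← himgP]; exact ⟨x, hx, rfl⟩))
    (fun x hx h => huniv (by rw [← h, ← himg]; exact ⟨x, hx, rfl⟩))
  have hlow : ∀ k ≤ 1, ∀ G, IsFaceOfDim (halfspaces a' d) k G →
      StrictlyPreserved (lastCoords (m := 2 * r) (k := 4) (by omega)) (halfspaces a' d) G := by
    rintro k hk G ⟨hG, hGne, hdim⟩
    obtain ⟨x, hx, hGx⟩ := hG.exists_eq_activeFace hGne
    have hxP := hG.subset hx
    -- A face of dimension at most 1 has at least `2 * r - 1` tight inequalities, hence a tight pair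
    -- in all blocks but one.
    have hrank := finrank_le_finrank_vectorSpan_activeFace_add hxP
    rw [← hGx, hdim, finrank_fintype_fun_eq_card, Fintype.card_fin] at hrank
    obtain ⟨t, ht⟩ := exists_pairs_of_card (S := activeSet a' d x) (by omega)
      (by rw [← himg]; exact ⟨x, hxP, rfl⟩) (by omega)
    rw [hGx] at hGne ⊢
    exact strictlyPreserved_of_pairs hn hne (by omega) t ht hGne
  refine ⟨flatMatrix n, alternatingW n, alternatingU n, flatBound n, d, φ,
    isPolygonMatrix_flatMatrix hn, flatBound_pos hn, isNGon_polyhedron hn hV hb hspan,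
    isPolytope_halfspaces hbdd, ?_, hlow 0 (by omega), hlow 1 le_rfl, ?_⟩
  · intro i k F hF
    replace hF : F.1 = {y ∈ halfspaces a (fun p => flatBound n p.2) |
        a (i, k) y = flatBound n k} := hF.trans (by rw [productPower_eq_halfspaces]; rfl)
    rw [hφ, hF]
    exact activeFace_commonActive_facet hfaces (i, k)
  · rintro ⟨F, hFe⟩ ⟨t, v, hv, hF⟩
    rw [hφ]
    change F = _ at hF
    change StrictlyPreserved _ _ (activeFace a' d (commonActive a _ F))
    obtain ⟨z, hz, -⟩ := (activeSet_image_polygon hn hV hb).symm.subset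
      (Or.inl rfl : ∅ ∈ polygonActiveSets n)
    have hFne : F.Nonempty := by
      rw [hF]
      refine ⟨Function.update v t z, ?_, fun i hi => Function.update_of_ne hi _ _⟩
      rw [Function.update_self]
      exact hz
    rw [productPower_eq_halfspaces] at hFe
    -- The tight set of `y` describes both `F` and its image under `φ`. Outside factor `t` the
    -- components of `y` are vertices, which gives the tight pairs.
    obtain ⟨y, hy, hFy⟩ := hFe.exists_eq_activeFace hFne
    have hyP := hFe.subset hy
    rw [hFy, commonActive_activeFace hyP]
    rw [hF] at hy
    refine strictlyPreserved_of_pairs hn hne (by omega) t (fun i hi => ?_) ?_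
    · have h1 := hv i hi
      rw [← hy.2 i hi] at h1
      exact exists_activeSet_eq_of_mem_exposedPoints hn hV hb h1
    · obtain ⟨x, hx, hact⟩ := hfaces.subset ⟨y, hyP, rfl⟩
      exact ⟨x, hx, hact.ge⟩
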